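/- Let $K$ be a field, let $\ell\ge 3$, and let $q\in K$ be a primitive $\ell$-th root of unity. Let $H=H_q(\ell)$ be the Iwahori–Hecke algebra of the symmetric group $W$ on $\{1,\dots,\ell\}$: the unital associative $K$-algebra with generators $T_1,\dots,T_{\ell-1}$ and relations $T_iT_{i+1}T_i=T_{i+1}T_iT_{i+1}$ for $1\le i<\ell-1$, $T_iT_j=T_jT_i$ for $|i-j|\ge 2$, and $T_i^2=(q-1)T_i+q$ for $1\le i\le \ell-1$. For $w\in W$ let $l(w)$ be the minimal length of an expression of $w$ as a product of the transpositions $s_i=(i\ \,i{+}1)$, and let $T_w=T_{i_1}\cdots T_{i_k}$ for any reduced expression $w=s_{i_1}\cdots s_{i_k}$, $k=l(w)$. For an interval $R\subseteq\{1,\dots,\ell\}$ let $W_R\le W$ be the group of permutations fixing every element outside $R$, and put $$x_R=\sum_{w\in W_R}T_w,\qquad y_R=\sum_{w\in W_R}(-q)^{-l(w)}T_w .$$ For $u\in K$ let $[k]_u!=\prod_{m=1}^k(1+u+\dots+u^{m-1})$. For $1\le r\le \ell-1$ and $s=\ell-r$ let $c_r=\bigl([s]_q!\,[r]_{q^{-1}}!\bigr)^{-1}$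 and $$\varepsilon_r=\begin{cases}c_r\,x_{[1,s]}\,y_{[s+1,\ell]} & r\text{ odd},\\ c_r\,y_{[1,r]}\,x_{[r+1,\ell]} & r\text{ even}.\end{cases}$$ Then the $\varepsilon_r$ ($1\le r\le\ell-1$) are idempotents, $\varepsilon_r\varepsilon_u=0$ for $r\ne u$, and for all $1\le r,u\le \ell-1$ $$\dim_K \varepsilon_rH\varepsilon_u=\begin{cases}0 & |r-u|\ge 2,\\ 1 & u=r\pm1,\\ 2 & r=u.\end{cases}$$ -/

import Mathlib

/-! The Iwahori-Hecke algebra of the symmetric group, its standard elements `T_w`,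
and the elements `x_R`, `y_R`, `ε_r`. -/

namespace IwahoriHecke

/-- The defining relations of the Iwahori-Hecke algebra `H_q(n)`. The index `i : Fin (n - 1)`
stands for the generator `T_{i+1}`, so that the generators are `T_1, …, T_{n-1}`. -/
inductive Rel (K : Type*) [Field K] (q : K) (n : ℕ) :
    FreeAlgebra K (Fin (n - 1)) → FreeAlgebra K (Fin (n - 1)) → Prop
  | braid (i j : Fin (n - 1)) (h : (i : ℕ) + 1 = (j : ℕ)) :
      Rel K q n
        (FreeAlgebra.ι K i * FreeAlgebra.ι K j * FreeAlgebra.ι K i)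
        (FreeAlgebra.ι K j * FreeAlgebra.ι K i * FreeAlgebra.ι K j)
  | comm (i j : Fin (n - 1)) (h : (i : ℕ) + 2 ≤ (j : ℕ) ∨ (j : ℕ) + 2 ≤ (i : ℕ)) :
      Rel K q n
        (FreeAlgebra.ι K i * FreeAlgebra.ι K j)
        (FreeAlgebra.ι K j * FreeAlgebra.ι K i)
  | quad (i : Fin (n - 1)) :
      Rel K q n
        (FreeAlgebra.ι K i * FreeAlgebra.ι K i)
        ((q - 1) • FreeAlgebra.ι K i + q • (1 : FreeAlgebra K (Fin (n - 1))))

/-- The Iwahori-Hecke algebra `H_q(n)` of the symmetric group on `n` letters, given by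
generators and relations. -/
def HeckeAlgebra (K : Type*) [Field K] (q : K) (n : ℕ) : Type _ :=
  RingQuot (Rel K q n)

noncomputable instance (K : Type*) [Field K] (q : K) (n : ℕ) : Ring (HeckeAlgebra K q n) :=
  inferInstanceAs (Ring (RingQuot (Rel K q n)))

noncomputable instance (K : Type*) [Field K] (q : K) (n : ℕ) :
    Algebra K (HeckeAlgebra K q n) :=
  inferInstanceAs (Algebra K (RingQuot (Rel K q n)))

/-- The generators of `H_q(n)`. -/
noncomputable def gen (K : Type*) [Field K] (q : K) (n : ℕ) (i : Fin (n - 1)) :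
    HeckeAlgebra K q n :=
  RingQuot.mkAlgHom K (Rel K q n) (FreeAlgebra.ι K i)

/-- The basic transpositions of the symmetric group. The set `{1, …, n}` is modelled by `Fin n`,
the element `j : Fin n` standing for `j + 1`; then `i : Fin (n - 1)` stands for the transposition
`(i+1  i+2)`. -/
def simpleTransposition (n : ℕ) (i : Fin (n - 1)) : Equiv.Perm (Fin n) :=
  Equiv.swap ⟨i, by omega⟩ ⟨(i : ℕ) + 1, by omega⟩

/-- `v` is an expression of `w` as a product of basic transpositions. -/
def IsWordFor (n : ℕ) (w : Equiv.Perm (Fin n)) (v : List (Fin (n - 1))) : Prop :=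
  (v.map (simpleTransposition n)).prod = w

theorem exists_isWordFor (n : ℕ) (w : Equiv.Perm (Fin n)) : ∃ v, IsWordFor n w v := by
  cases n with
  | zero => exact ⟨[], Subsingleton.elim _ _⟩
  | succ m =>
    have hw : w ∈ Submonoid.closure
        (Set.range fun i : Fin m => Equiv.swap i.castSucc i.succ) := by
      rw [Equiv.Perm.mclosure_swap_castSucc_succ]
      exact Submonoid.mem_top w
    induction hw using Submonoid.closure_induction with
    | mem x hx =>
      obtain ⟨i, rfl⟩ := hx
      exact ⟨[i], List.prod_singleton⟩
    | one => exact ⟨[], rfl⟩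
    | mul x y _ _ hx hy =>
      obtain ⟨a, ha⟩ := hx
      obtain ⟨b, hb⟩ := hy
      refine ⟨a ++ b, ?_⟩
      unfold IsWordFor at *
      rw [List.map_append, List.prod_append, ha, hb]

/-- The length `l(w)`: the minimal `k` such that `w` is a product of `k` basic transpositions. -/
noncomputable def length (n : ℕ) (w : Equiv.Perm (Fin n)) : ℕ :=
  sInf {k | ∃ v, IsWordFor n w v ∧ v.length = k}

theorem exists_reducedWord (n : ℕ) (w : Equiv.Perm (Fin n)) :
    ∃ v, IsWordFor n w v ∧ v.length = length n w :=
  Nat.sInf_mem (s := {k | ∃ v, IsWordFor n w v ∧ v.length = k})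
    ((exists_isWordFor n w).elim fun v hv => ⟨v.length, v, hv, rfl⟩)

/-- A reduced expression of `w`. -/
noncomputable def reducedWord (n : ℕ) (w : Equiv.Perm (Fin n)) : List (Fin (n - 1)) :=
  (exists_reducedWord n w).choose

/-- The standard basis element `T_w = T_{v_1} ⋯ T_{v_k}`, where `w = v_1 ⋯ v_k` is a reduced
expression (by the braid relations, the product is the same for every reduced expression). -/
noncomputable def T (K : Type*) [Field K] (q : K) (n : ℕ) (w : Equiv.Perm (Fin n)) :
    HeckeAlgebra K q n :=
  ((reducedWord n w).map (gen K q n)).prod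

/-- The group `W_R` of permutations of the interval `R = [a, b]` of `{1, …, n}`, as the set of
permutations of `{1, …, n}` that fix every number outside `R`. -/
def intervalPerms (n a b : ℕ) : Finset (Equiv.Perm (Fin n)) :=
  Finset.univ.filter fun w => ∀ j : Fin n, (j : ℕ) + 1 ∉ Finset.Icc a b → w j = j

/-- `x_R = ∑_{w ∈ W_R} T_w` for `R = [a, b]`. -/
noncomputable def x (K : Type*) [Field K] (q : K) (n a b : ℕ) : HeckeAlgebra K q n :=
  ∑ w ∈ intervalPerms n a b, T K q n w

/-- `y_R = ∑_{w ∈ W_R} (-q)^{-l(w)} T_w` for `R = [a, b]`. -/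
noncomputable def y (K : Type*) [Field K] (q : K) (n a b : ℕ) : HeckeAlgebra K q n :=
  ∑ w ∈ intervalPerms n a b, (-q) ^ (-(length n w : ℤ)) • T K q n w

/-- `[k]_u! = ∏_{m=1}^k (1 + u + ⋯ + u^{m-1})`. -/
def qFactorial {K : Type*} [Field K] (u : K) (k : ℕ) : K :=
  ∏ m ∈ Finset.Icc 1 k, ∑ i ∈ Finset.range m, u ^ i

/-- The element `ε_r` of `H_q(ℓ)`, for `1 ≤ r ≤ ℓ - 1`, with `s = ℓ - r`. The scalar is
`c_r = ([s]_q! [r]_{q⁻¹}!)⁻¹`. -/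
noncomputable def eps (K : Type*) [Field K] (q : K) (l r : ℕ) : HeckeAlgebra K q l :=
  (qFactorial q (l - r) * qFactorial q⁻¹ r)⁻¹ •
    (if Odd r then x K q l 1 (l - r) * y K q l (l - r + 1) l
      else y K q l 1 r * x K q l (r + 1) l)

/-- The `K`-subspace `a H b = {a h b | h ∈ H}` of `H = H_q(n)`. -/
noncomputable def corner (K : Type*) [Field K] (q : K) (n : ℕ) (a b : HeckeAlgebra K q n) :
    Submodule K (HeckeAlgebra K q n) :=
  LinearMap.range (LinearMap.mulLeftRight K (a, b))

end IwahoriHecke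

/-! Each `ε_r` is a normalised product of two commuting block sums, one on `[1, k]` and one on
`[k+1, ℓ]`. On one block the generators act by the eigenvalue `q`, on the other by `-1`. The
weighted sum over `W_R` with eigenvalue `μ` multiplies every joint `μ`-eigenvector by the Poincaré
polynomial of the block at `μ²q⁻¹`, that is, at `q` or `q⁻¹`. Both blocks are shorter than the order
`ℓ` of `q`, so these scalars are invertible. Hence a block idempotent `e` fixes every vector with
its block eigenvalues, in any representation (`rep_blockIdempotent`); applied to `e` itself in the
left regular representation, this gives idempotency. Orthogonality holds because for `r ≠ u` some
generator `T_i` lies in a block of `ε_r` and in a block of `ε_u` with different eigenvalues.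

For the dimensions, the left ideal `He` is an induced module. Its model is the space of functions on
words in two letters with as many letters `false` as the first block has places: the word `w`
corresponds to `T_d e`, with `d` the stable sorting permutation of `w`, a minimal coset
representative. Evaluation at the sorted word identifies `e'He` with the block eigenvectors for `e'`
in this model (`rank_corner_eq`). The map `wordMap` back to `H` yields injectivity, so linear
independence of the `T_w` is never needed.

The eigenvector equations can be solved by hand. In each block of `e'` one letter, the majority, is
prescribed. Two equal adjacent letters of the other kind force the value 0, and exchanging two
letters within a block multiplies the value by a nonzero scalar. So the support has at most one
deviating letter per block, and a solution is determined by its values at four words indexed by `(a,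
b) ∈ {0,1}²`, the numbers of deviations in the two blocks. The number of letters `false` fixes `a -
b = ±(r - u)`, which leaves 2, 1 or 0 pairs. -/

namespace IwahoriHecke

/-! ### The length function of the symmetric group -/

/-- The smaller of the two points exchanged by the `i`-th basic transposition. -/
def lo {n : ℕ} (i : Fin (n - 1)) : Fin n := ⟨i, by omega⟩

/-- The larger of the two points exchanged by the `i`-th basic transposition. -/
def hi {n : ℕ} (i : Fin (n - 1)) : Fin n := ⟨(i : ℕ) + 1, by omega⟩

@[simp] theorem val_lo {n : ℕ} (i : Fin (n - 1)) : ((lo i : Fin n) : ℕ) = i := rfl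

@[simp] theorem val_hi {n : ℕ} (i : Fin (n - 1)) : ((hi i : Fin n) : ℕ) = i + 1 := rfl

theorem lo_lt_hi {n : ℕ} (i : Fin (n - 1)) : (lo i : Fin n) < hi i := by
  simp [Fin.lt_def]

theorem lo_ne_hi {n : ℕ} (i : Fin (n - 1)) : (lo i : Fin n) ≠ hi i := (lo_lt_hi i).ne

theorem simpleTransposition_eq (n : ℕ) (i : Fin (n - 1)) :
    simpleTransposition n i = Equiv.swap (lo i) (hi i) := rfl

@[simp] theorem simpleTransposition_lo {n : ℕ} (i : Fin (n - 1)) :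
    simpleTransposition n i (lo i) = hi i := Equiv.swap_apply_left _ _

@[simp] theorem simpleTransposition_hi {n : ℕ} (i : Fin (n - 1)) :
    simpleTransposition n i (hi i) = lo i := Equiv.swap_apply_right _ _

theorem simpleTransposition_of_ne {n : ℕ} (i : Fin (n - 1)) {a : Fin n} (h₁ : a ≠ lo i)
    (h₂ : a ≠ hi i) : simpleTransposition n i a = a := Equiv.swap_apply_of_ne_of_ne h₁ h₂

@[simp] theorem simpleTransposition_mul_self {n : ℕ} (i : Fin (n - 1)) :
    simpleTransposition n i * simpleTransposition n i = 1 := Equiv.swap_mul_self _ _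

@[simp] theorem simpleTransposition_inv {n : ℕ} (i : Fin (n - 1)) :
    (simpleTransposition n i)⁻¹ = simpleTransposition n i := Equiv.swap_inv _ _

@[simp] theorem simpleTransposition_apply_apply {n : ℕ} (i : Fin (n - 1)) (a : Fin n) :
    simpleTransposition n i (simpleTransposition n i a) = a := Equiv.swap_apply_self _ _ _

@[simp] theorem simpleTransposition_mul_cancel {n : ℕ} (i : Fin (n - 1))
    (w : Equiv.Perm (Fin n)) : simpleTransposition n i * (simpleTransposition n i * w) = w := by
  rw [← mul_assoc, simpleTransposition_mul_self, one_mul]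

theorem simpleTransposition_lt {n : ℕ} (i : Fin (n - 1)) {a b : Fin n} (hab : a < b)
    (h : ¬ (a = lo i ∧ b = hi i)) :
    simpleTransposition n i a < simpleTransposition n i b := by
  rw [simpleTransposition_eq]
  simp only [Equiv.swap_apply_def, Fin.ext_iff, val_lo, val_hi] at *
  split_ifs <;> simp only [Fin.lt_def, val_lo, val_hi] at * <;> omega

/-- The inversions of `w⁻¹`. -/
def inversions {n : ℕ} (w : Equiv.Perm (Fin n)) : Finset (Fin n × Fin n) :=
  Finset.univ.filter fun p => p.1 < p.2 ∧ w⁻¹ p.2 < w⁻¹ p.1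

theorem mem_inversions {n : ℕ} {w : Equiv.Perm (Fin n)} {p : Fin n × Fin n} :
    p ∈ inversions w ↔ p.1 < p.2 ∧ w⁻¹ p.2 < w⁻¹ p.1 := by
  simp [inversions]

theorem inv_mul_apply_lo {n : ℕ} (i : Fin (n - 1)) (w : Equiv.Perm (Fin n)) :
    (simpleTransposition n i * w)⁻¹ (lo i) = w⁻¹ (hi i) := by
  simp [mul_inv_rev, Equiv.Perm.mul_apply]

theorem inv_mul_apply_hi {n : ℕ} (i : Fin (n - 1)) (w : Equiv.Perm (Fin n)) :
    (simpleTransposition n i * w)⁻¹ (hi i) = w⁻¹ (lo i) := by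
  simp [mul_inv_rev, Equiv.Perm.mul_apply]

theorem inv_mul_apply_of_ne {n : ℕ} (i : Fin (n - 1)) (w : Equiv.Perm (Fin n)) {a : Fin n}
    (h₁ : a ≠ lo i) (h₂ : a ≠ hi i) :
    (simpleTransposition n i * w)⁻¹ a = w⁻¹ a := by
  simp [mul_inv_rev, Equiv.Perm.mul_apply, simpleTransposition_of_ne i h₁ h₂]

/-- A basic transposition keeps the order of every pair except its own two points, so it carries the
old inversions bijectively to the new ones other than `(lo i, hi i)`. -/
theorem card_inversions_of_lt {n : ℕ} (i : Fin (n - 1)) {w : Equiv.Perm (Fin n)}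
    (h : w⁻¹ (lo i) < w⁻¹ (hi i)) :
    (inversions (simpleTransposition n i * w)).card = (inversions w).card + 1 := by
  let e : Fin n × Fin n ≃ Fin n × Fin n :=
    (simpleTransposition n i).prodCongr (simpleTransposition n i)
  have key : inversions (simpleTransposition n i * w)
      = insert (lo i, hi i) ((inversions w).map e.toEmbedding) := by
    ext ⟨a, b⟩
    have hmap : (a, b) ∈ (inversions w).map e.toEmbedding ↔
        (simpleTransposition n i a, simpleTransposition n i b) ∈ inversions w := by
      rw [Finset.mem_map_equiv]
      rfl
    rw [Finset.mem_insert, hmap, mem_inversions, mem_inversions]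
    simp only [Prod.mk.injEq, mul_inv_rev, Equiv.Perm.mul_apply, simpleTransposition_inv]
    constructor
    · rintro ⟨h₁, h₂⟩
      by_cases hab : a = lo i ∧ b = hi i
      · exact Or.inl hab
      · exact Or.inr ⟨simpleTransposition_lt i h₁ hab, h₂⟩
    · rintro (⟨rfl, rfl⟩ | ⟨h₁, h₂⟩)
      · exact ⟨lo_lt_hi i, by simpa using h⟩
      · refine ⟨?_, h₂⟩
        have := simpleTransposition_lt i h₁ (by
          rintro ⟨h₃, h₄⟩
          rw [h₃, h₄] at h₂
          exact absurd h h₂.not_gt)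
        simpa using this
  rw [key, Finset.card_insert_of_notMem, Finset.card_map]
  rw [Finset.mem_map_equiv]
  intro hm
  have := (mem_inversions.1 hm).1
  simp only [e, Equiv.prodCongr_symm, Equiv.prodCongr_apply, Prod.map] at this
  have h₁ : (simpleTransposition n i).symm (lo i) = hi i := by simp [Equiv.symm_apply_eq]
  have h₂ : (simpleTransposition n i).symm (hi i) = lo i := by simp [Equiv.symm_apply_eq]
  rw [h₁, h₂] at this
  exact absurd this (lo_lt_hi i).not_gt

theorem card_inversions_of_gt {n : ℕ} (i : Fin (n - 1)) {w : Equiv.Perm (Fin n)}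
    (h : w⁻¹ (hi i) < w⁻¹ (lo i)) :
    (inversions (simpleTransposition n i * w)).card + 1 = (inversions w).card := by
  have := card_inversions_of_lt i (w := simpleTransposition n i * w)
    (by rwa [inv_mul_apply_lo, inv_mul_apply_hi])
  rw [← this, simpleTransposition_mul_cancel]

theorem inv_lo_lt_or_gt {n : ℕ} (i : Fin (n - 1)) (w : Equiv.Perm (Fin n)) :
    w⁻¹ (lo i) < w⁻¹ (hi i) ∨ w⁻¹ (hi i) < w⁻¹ (lo i) :=
  lt_or_gt_of_ne fun h => lo_ne_hi i (w⁻¹.injective h)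

theorem card_inversions_le_of_isWordFor {n : ℕ} {w : Equiv.Perm (Fin n)}
    {v : List (Fin (n - 1))} (h : IsWordFor n w v) : (inversions w).card ≤ v.length := by
  induction v generalizing w with
  | nil =>
    have : w = 1 := by simpa [IsWordFor] using h.symm
    subst this
    rw [Finset.card_eq_zero.2]
    · exact Nat.zero_le _
    · ext p
      simp only [mem_inversions, inv_one, Equiv.Perm.one_apply, Finset.notMem_empty, iff_false]
      exact fun h => absurd h.1 h.2.not_gt
  | cons i v ih =>
    have hw : w = simpleTransposition n i * (v.map (simpleTransposition n)).prod := by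
      simpa [IsWordFor] using h.symm
    have := ih (w := (v.map (simpleTransposition n)).prod) rfl
    rw [List.length_cons, hw]
    rcases inv_lo_lt_or_gt i (v.map (simpleTransposition n)).prod with h' | h'
    · have := card_inversions_of_lt i h'
      omega
    · have := card_inversions_of_gt i h'
      omega

theorem eq_one_of_forall_lt {n : ℕ} {w : Equiv.Perm (Fin n)}
    (h : ∀ i : Fin (n - 1), w⁻¹ (lo i) < w⁻¹ (hi i)) : w = 1 := by
  have hmono : StrictMono (w⁻¹ : Equiv.Perm (Fin n)) := by
    cases n with
    | zero => exact fun a => a.elim0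
    | succ m => exact Fin.strictMono_iff_lt_succ.2 fun i => h i
  exact inv_eq_one.1 ((Equiv.Perm.monotone_iff _).1 hmono.monotone)

/-- Bubble sort: while `w ≠ 1` there is a descent, and removing it costs one letter and one
inversion. -/
theorem exists_isWordFor_length_eq {n : ℕ} (w : Equiv.Perm (Fin n)) :
    ∃ v, IsWordFor n w v ∧ v.length = (inversions w).card := by
  induction hk : (inversions w).card generalizing w with
  | zero =>
    refine ⟨[], ?_, rfl⟩
    have : w = 1 := eq_one_of_forall_lt fun i => by
      refine (inv_lo_lt_or_gt i w).resolve_right fun h => ?_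
      have := card_inversions_of_gt i h
      omega
    simp [IsWordFor, this]
  | succ k ih =>
    by_cases h : ∀ i : Fin (n - 1), w⁻¹ (lo i) < w⁻¹ (hi i)
    · have h1 := eq_one_of_forall_lt h
      have := card_inversions_le_of_isWordFor (w := w) (v := []) (by simp [IsWordFor, h1])
      simp only [List.length_nil] at this
      omega
    · push Not at h
      obtain ⟨i, hi'⟩ := h
      have hgt := (inv_lo_lt_or_gt i w).resolve_left hi'.not_gt
      have := card_inversions_of_gt i hgt
      obtain ⟨v, hv, hl⟩ := ih (simpleTransposition n i * w) (by omega)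
      refine ⟨i :: v, ?_, by simp [hl]⟩
      unfold IsWordFor at *
      rw [List.map_cons, List.prod_cons, hv, simpleTransposition_mul_cancel]

theorem length_le_of_isWordFor {n : ℕ} {w : Equiv.Perm (Fin n)} {v : List (Fin (n - 1))}
    (h : IsWordFor n w v) : length n w ≤ v.length :=
  Nat.sInf_le ⟨v, h, rfl⟩

theorem length_eq_card_inversions {n : ℕ} (w : Equiv.Perm (Fin n)) :
    length n w = (inversions w).card := by
  obtain ⟨v, hv, hl⟩ := exists_isWordFor_length_eq w
  obtain ⟨v', hv', hl'⟩ := exists_reducedWord n w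
  exact le_antisymm (hl ▸ length_le_of_isWordFor hv)
    (hl' ▸ card_inversions_le_of_isWordFor hv')

theorem length_mul_of_lt {n : ℕ} (i : Fin (n - 1)) {w : Equiv.Perm (Fin n)}
    (h : w⁻¹ (lo i) < w⁻¹ (hi i)) :
    length n (simpleTransposition n i * w) = length n w + 1 := by
  rw [length_eq_card_inversions, length_eq_card_inversions, card_inversions_of_lt i h]

theorem length_mul_of_gt {n : ℕ} (i : Fin (n - 1)) {w : Equiv.Perm (Fin n)}
    (h : w⁻¹ (hi i) < w⁻¹ (lo i)) :
    length n (simpleTransposition n i * w) + 1 = length n w := by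
  rw [length_eq_card_inversions, length_eq_card_inversions, card_inversions_of_gt i h]

@[simp] theorem length_one (n : ℕ) : length n 1 = 0 :=
  Nat.le_zero.1 (length_le_of_isWordFor (v := []) (by simp [IsWordFor]))

theorem isWordFor_reverse {n : ℕ} {w : Equiv.Perm (Fin n)} {v : List (Fin (n - 1))}
    (h : IsWordFor n w v) : IsWordFor n w⁻¹ v.reverse := by
  unfold IsWordFor at *
  rw [← h, List.prod_inv_reverse, List.map_reverse, List.map_map]
  congr 3

theorem length_inv_le {n : ℕ} (w : Equiv.Perm (Fin n)) : length n w⁻¹ ≤ length n w := by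
  obtain ⟨v, hv, hl⟩ := exists_reducedWord n w
  rw [← hl, ← List.length_reverse]
  exact length_le_of_isWordFor (isWordFor_reverse hv)

@[simp] theorem length_inv {n : ℕ} (w : Equiv.Perm (Fin n)) : length n w⁻¹ = length n w :=
  le_antisymm (length_inv_le w) (by simpa using length_inv_le w⁻¹)

theorem length_mul_right_of_lt {n : ℕ} (i : Fin (n - 1)) {w : Equiv.Perm (Fin n)}
    (h : w (lo i) < w (hi i)) :
    length n (w * simpleTransposition n i) = length n w + 1 := by
  rw [← length_inv, mul_inv_rev, simpleTransposition_inv, length_mul_of_lt i (by simpa using h),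
    length_inv]

/-! ### The standard elements `T_w` -/

section Gen

variable (K : Type*) [Field K] (q : K) (n : ℕ)

/-- The quotient map from the free algebra onto the Hecke algebra. -/
noncomputable def mk : FreeAlgebra K (Fin (n - 1)) →ₐ[K] HeckeAlgebra K q n :=
  RingQuot.mkAlgHom K (Rel K q n)

theorem mk_ι (i : Fin (n - 1)) : mk K q n (FreeAlgebra.ι K i) = gen K q n i := rfl

theorem mk_rel {a b : FreeAlgebra K (Fin (n - 1))} (h : Rel K q n a b) :
    mk K q n a = mk K q n b := RingQuot.mkAlgHom_rel K h

theorem mk_surjective : Function.Surjective (mk K q n) := RingQuot.mkAlgHom_surjective K _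

theorem gen_braid (i j : Fin (n - 1)) (h : (i : ℕ) + 1 = j) :
    gen K q n i * gen K q n j * gen K q n i = gen K q n j * gen K q n i * gen K q n j := by
  simpa only [map_mul, mk_ι] using mk_rel K q n (Rel.braid i j h)

theorem gen_comm (i j : Fin (n - 1)) (h : (i : ℕ) + 2 ≤ j ∨ (j : ℕ) + 2 ≤ i) :
    gen K q n i * gen K q n j = gen K q n j * gen K q n i := by
  simpa only [map_mul, mk_ι] using mk_rel K q n (Rel.comm i j h)

theorem gen_mul_self (i : Fin (n - 1)) :
    gen K q n i * gen K q n i = (q - 1) • gen K q n i + q • 1 := by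
  simpa only [map_mul, map_add, map_smul, map_one, mk_ι] using mk_rel K q n (Rel.quad i)

theorem adjoin_range_gen : Algebra.adjoin K (Set.range (gen K q n)) = ⊤ := by
  have h : Set.range (gen K q n) = mk K q n '' Set.range (FreeAlgebra.ι K) := by
    rw [← Set.range_comp]
    rfl
  rw [h, ← AlgHom.map_adjoin, FreeAlgebra.adjoin_range_ι, Algebra.map_top]
  exact (AlgHom.range_eq_top _).2 (mk_surjective K q n)

/-- The universal property of the Hecke algebra. -/
noncomputable def lift {K : Type*} [Field K] {q : K} {n : ℕ} {A : Type*} [Ring A] [Algebra K A]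
    (t : Fin (n - 1) → A)
    (braid : ∀ i j : Fin (n - 1), (i : ℕ) + 1 = j → t i * t j * t i = t j * t i * t j)
    (comm : ∀ i j : Fin (n - 1), (i : ℕ) + 2 ≤ j → t i * t j = t j * t i)
    (quad : ∀ i, t i * t i = (q - 1) • t i + q • 1) : HeckeAlgebra K q n →ₐ[K] A :=
  RingQuot.liftAlgHom K (s := Rel K q n) ⟨FreeAlgebra.lift K t, by
    rintro _ _ (⟨i, j, h⟩ | ⟨i, j, h | h⟩ | ⟨i⟩)
    · simpa using braid i j h
    · simpa using comm i j h
    · simpa using (comm j i h).symm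
    · simpa using quad i⟩

theorem lift_gen {K : Type*} [Field K] {q : K} {n : ℕ} {A : Type*} [Ring A] [Algebra K A]
    (t : Fin (n - 1) → A)
    (braid : ∀ i j : Fin (n - 1), (i : ℕ) + 1 = j → t i * t j * t i = t j * t i * t j)
    (comm : ∀ i j : Fin (n - 1), (i : ℕ) + 2 ≤ j → t i * t j = t j * t i)
    (quad : ∀ i, t i * t i = (q - 1) • t i + q • 1) (i : Fin (n - 1)) :
    lift t braid comm quad (gen K q n i) = t i :=
  (RingQuot.liftAlgHom_mkAlgHom_apply K _ _ _).trans (FreeAlgebra.lift_ι_apply t i)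

end Gen

/-- `v` is a reduced expression of `w`. -/
def IsReducedWord (n : ℕ) (w : Equiv.Perm (Fin n)) (v : List (Fin (n - 1))) : Prop :=
  IsWordFor n w v ∧ v.length = length n w

theorem isReducedWord_reducedWord (n : ℕ) (w : Equiv.Perm (Fin n)) :
    IsReducedWord n w (reducedWord n w) := (exists_reducedWord n w).choose_spec

/-- If `s_i` lengthened `w`, the tail would express `s_i w` with fewer letters than its length. -/
theorem IsReducedWord.gt_and_tail {n : ℕ} {w : Equiv.Perm (Fin n)} {i : Fin (n - 1)}
    {v : List (Fin (n - 1))} (h : IsReducedWord n w (i :: v)) :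
    w⁻¹ (hi i) < w⁻¹ (lo i) ∧ IsReducedWord n (simpleTransposition n i * w) v := by
  obtain ⟨h₁, h₂⟩ := h
  have hv : IsWordFor n (simpleTransposition n i * w) v := by
    unfold IsWordFor at *
    rw [← h₁, List.map_cons, List.prod_cons, simpleTransposition_mul_cancel]
  have hle := length_le_of_isWordFor hv
  rw [List.length_cons] at h₂
  have hgt := (inv_lo_lt_or_gt i w).resolve_left fun hlt => by
    have := length_mul_of_lt i hlt
    omega
  have := length_mul_of_gt i hgt
  exact ⟨hgt, hv, by omega⟩

theorem IsReducedWord.cons {n : ℕ} {w : Equiv.Perm (Fin n)} {i : Fin (n - 1)}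
    {v : List (Fin (n - 1))} (hgt : w⁻¹ (hi i) < w⁻¹ (lo i))
    (h : IsReducedWord n (simpleTransposition n i * w) v) : IsReducedWord n w (i :: v) := by
  obtain ⟨h₁, h₂⟩ := h
  have := length_mul_of_gt i hgt
  refine ⟨?_, by rw [List.length_cons]; omega⟩
  unfold IsWordFor at *
  rw [List.map_cons, List.prod_cons, h₁, simpleTransposition_mul_cancel]

theorem simpleTransposition_comm {n : ℕ} (i j : Fin (n - 1)) (h : (i : ℕ) + 2 ≤ j) :
    simpleTransposition n i * simpleTransposition n j
      = simpleTransposition n j * simpleTransposition n i := by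
  refine (Equiv.Perm.Disjoint.commute fun a => ?_).eq
  simp only [simpleTransposition_eq]
  by_cases ha : a = lo i ∨ a = hi i
  · refine Or.inr (Equiv.swap_apply_of_ne_of_ne ?_ ?_) <;>
    · rw [Ne, Fin.ext_iff]
      rcases ha with rfl | rfl <;> simp <;> omega
  · push Not at ha
    exact Or.inl (Equiv.swap_apply_of_ne_of_ne ha.1 ha.2)

theorem simpleTransposition_braid {n : ℕ} (i j : Fin (n - 1)) (h : (i : ℕ) + 1 = j) :
    simpleTransposition n i * (simpleTransposition n j * simpleTransposition n i)
      = simpleTransposition n j * (simpleTransposition n i * simpleTransposition n j) := by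
  have hij : (hi i : Fin n) = lo j := Fin.ext h
  have h₁ : (lo i : Fin n) ≠ lo j := by simp [Fin.ext_iff]; omega
  have h₂ : (lo i : Fin n) ≠ hi j := by simp [Fin.ext_iff]; omega
  have h₃ := lo_ne_hi j
  simp only [simpleTransposition_eq, hij]
  ext a
  simp only [Equiv.Perm.mul_apply, Equiv.swap_apply_def]
  split_ifs <;> simp_all

/-! ### Matsumoto's theorem and products of `T_w` with generators. -/

section StandardElements

variable (K : Type*) [Field K] (q : K) (n : ℕ)

/-- Matsumoto's theorem for the generators of the Hecke algebra. -/
theorem prod_gen_eq_of_isReducedWord {w : Equiv.Perm (Fin n)} {v v' : List (Fin (n - 1))}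
    (h : IsReducedWord n w v) (h' : IsReducedWord n w v') :
    (v.map (gen K q n)).prod = (v'.map (gen K q n)).prod := by
  induction hk : length n w using Nat.strong_induction_on generalizing w v v' with
  | _ k ih =>
  subst hk
  -- Two reduced words with different first letters are compared through two further reduced words,
  -- which differ from each other by a single relation and agree with `i :: a`, respectively `j ::
  -- b`, in the first letter; induction applies to the tails.
  have step : ∀ (i j : Fin (n - 1)) (a b : List (Fin (n - 1))), i < j →
      IsReducedWord n w (i :: a) → IsReducedWord n w (j :: b) →
      ((i :: a).map (gen K q n)).prod = ((j :: b).map (gen K q n)).prod := by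
    intro i j a b hij ha hb
    obtain ⟨hgi, ha'⟩ := ha.gt_and_tail
    obtain ⟨hgj, hb'⟩ := hb.gt_and_tail
    have hli := length_mul_of_gt i hgi
    have hlj := length_mul_of_gt j hgj
    rw [Fin.lt_def] at hij
    -- If `i` and `j` are adjacent, `w⁻¹` reverses the order of three consecutive points, so `w` has
    -- reduced words starting with `i j i` and `j i j` and sharing the remainder `c`. Otherwise the
    -- two descents are independent and `i j`, `j i` play this role.
    by_cases hj : (i : ℕ) + 1 = j
    · have hp : (hi i : Fin n) = lo j := Fin.ext hj
      have h₁ : (hi j : Fin n) ≠ lo i := by simp [Fin.ext_iff]; omega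
      have h₂ : (hi j : Fin n) ≠ hi i := by simp [Fin.ext_iff]; omega
      have h₃ : (lo i : Fin n) ≠ lo j := by simp [Fin.ext_iff]; omega
      have g₁ : (simpleTransposition n i * w)⁻¹ (hi j) < (simpleTransposition n i * w)⁻¹ (lo j) := by
        rw [inv_mul_apply_of_ne i w h₁ h₂, ← hp, inv_mul_apply_hi]
        rw [← hp] at hgj
        exact hgj.trans hgi
      have g₂ : (simpleTransposition n j * (simpleTransposition n i * w))⁻¹ (hi i)
          < (simpleTransposition n j * (simpleTransposition n i * w))⁻¹ (lo i) := by
        rw [hp, inv_mul_apply_lo, inv_mul_apply_of_ne j _ h₃ h₁.symm,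
          inv_mul_apply_of_ne i w h₁ h₂, inv_mul_apply_lo, hp]
        exact hgj
      obtain ⟨c, hc⟩ : ∃ c, IsReducedWord n (simpleTransposition n i *
          (simpleTransposition n j * (simpleTransposition n i * w))) c := exists_reducedWord n _
      have g₃ : (simpleTransposition n j * w)⁻¹ (hi i) < (simpleTransposition n j * w)⁻¹ (lo i) := by
        rw [hp, inv_mul_apply_lo, inv_mul_apply_of_ne j w h₃ h₁.symm]
        rw [← hp] at hgj
        exact hgj.trans hgi
      have g₄ : (simpleTransposition n i * (simpleTransposition n j * w))⁻¹ (hi j)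
          < (simpleTransposition n i * (simpleTransposition n j * w))⁻¹ (lo j) := by
        rw [inv_mul_apply_of_ne i _ h₁ h₂, inv_mul_apply_hi j, ← hp, inv_mul_apply_hi i,
          inv_mul_apply_of_ne j w h₃ h₁.symm]
        exact hgi
      have hbr : simpleTransposition n i * (simpleTransposition n j *
          (simpleTransposition n i * w)) = simpleTransposition n j *
          (simpleTransposition n i * (simpleTransposition n j * w)) := by
        simpa only [mul_assoc] using congrArg (· * w) (simpleTransposition_braid i j hj)
      have r₁ := IsReducedWord.cons g₁ (IsReducedWord.cons g₂ hc)
      rw [hbr] at hc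
      have r₂ := IsReducedWord.cons g₃ (IsReducedWord.cons g₄ hc)
      rw [List.map_cons, List.map_cons, List.prod_cons, List.prod_cons,
        ih _ (by omega) ha' r₁ rfl, ih _ (by omega) hb' r₂ rfl]
      simp only [List.map_cons, List.prod_cons]
      simpa only [mul_assoc] using
        congrArg (· * (c.map (gen K q n)).prod) (gen_braid K q n i j hj)
    · have hj' : (i : ℕ) + 2 ≤ j := by omega
      have h₁ : (lo j : Fin n) ≠ lo i := by simp [Fin.ext_iff]; omega
      have h₂ : (lo j : Fin n) ≠ hi i := by simp [Fin.ext_iff]; omega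
      have h₃ : (hi j : Fin n) ≠ lo i := by simp [Fin.ext_iff]; omega
      have h₄ : (hi j : Fin n) ≠ hi i := by simp [Fin.ext_iff]; omega
      obtain ⟨c, hc⟩ : ∃ c, IsReducedWord n (simpleTransposition n j *
          (simpleTransposition n i * w)) c := exists_reducedWord n _
      have hcm : simpleTransposition n j * (simpleTransposition n i * w)
          = simpleTransposition n i * (simpleTransposition n j * w) := by
        rw [← mul_assoc, ← mul_assoc, simpleTransposition_comm i j hj']
      have r₁ := IsReducedWord.cons (i := j) (by
        rwa [inv_mul_apply_of_ne i w h₁ h₂, inv_mul_apply_of_ne i w h₃ h₄]) hc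
      rw [hcm] at hc
      have r₂ := IsReducedWord.cons (i := i) (by
        rwa [inv_mul_apply_of_ne j w h₁.symm h₃.symm,
          inv_mul_apply_of_ne j w h₂.symm h₄.symm]) hc
      rw [List.map_cons, List.map_cons, List.prod_cons, List.prod_cons,
        ih _ (by omega) ha' r₁ rfl, ih _ (by omega) hb' r₂ rfl]
      simp only [List.map_cons, List.prod_cons]
      rw [← mul_assoc, ← mul_assoc, gen_comm K q n i j (Or.inl hj')]
  cases v with
  | nil =>
    cases v' with
    | nil => rfl
    | cons j b =>
      have h₁ := h.2
      have h₂ := h'.2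
      simp only [List.length_nil, List.length_cons] at h₁ h₂
      omega
  | cons i a =>
    cases v' with
    | nil =>
      have h₁ := h.2
      have h₂ := h'.2
      simp only [List.length_nil, List.length_cons] at h₁ h₂
      omega
    | cons j b =>
      rcases lt_trichotomy i j with hij | rfl | hij
      · exact step i j a b hij h h'
      · obtain ⟨hg, ha⟩ := h.gt_and_tail
        have := length_mul_of_gt i hg
        rw [List.map_cons, List.map_cons, List.prod_cons, List.prod_cons,
          ih _ (by omega) ha h'.gt_and_tail.2 rfl]
      · exact (step j i b a hij h' h).symm

theorem T_eq_of_isReducedWord {w : Equiv.Perm (Fin n)} {v : List (Fin (n - 1))}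
    (h : IsReducedWord n w v) : T K q n w = (v.map (gen K q n)).prod :=
  prod_gen_eq_of_isReducedWord K q n (isReducedWord_reducedWord n w) h

theorem T_one : T K q n 1 = 1 :=
  (T_eq_of_isReducedWord K q n (v := []) ⟨by simp [IsWordFor], by simp⟩).trans (by simp)

variable {n}

theorem gen_mul_T_of_lt (i : Fin (n - 1)) {w : Equiv.Perm (Fin n)}
    (h : w⁻¹ (lo i) < w⁻¹ (hi i)) :
    gen K q n i * T K q n w = T K q n (simpleTransposition n i * w) := by
  have := IsReducedWord.cons (i := i) (w := simpleTransposition n i * w)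
    (v := reducedWord n w) (by rwa [inv_mul_apply_hi, inv_mul_apply_lo])
    (by rw [simpleTransposition_mul_cancel]; exact isReducedWord_reducedWord n w)
  rw [T_eq_of_isReducedWord K q n this, List.map_cons, List.prod_cons]
  rfl

theorem gen_mul_T_of_gt (i : Fin (n - 1)) {w : Equiv.Perm (Fin n)}
    (h : w⁻¹ (hi i) < w⁻¹ (lo i)) :
    gen K q n i * T K q n w
      = (q - 1) • T K q n w + q • T K q n (simpleTransposition n i * w) := by
  have := gen_mul_T_of_lt K q i (w := simpleTransposition n i * w)
    (by rwa [inv_mul_apply_hi, inv_mul_apply_lo])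
  rw [simpleTransposition_mul_cancel] at this
  rw [← this, ← mul_assoc, gen_mul_self, add_mul, smul_mul_assoc, smul_mul_assoc, one_mul]

theorem T_mul_gen_of_lt (i : Fin (n - 1)) {w : Equiv.Perm (Fin n)}
    (h : w (lo i) < w (hi i)) :
    T K q n w * gen K q n i = T K q n (w * simpleTransposition n i) := by
  have hr : IsReducedWord n (w * simpleTransposition n i) (reducedWord n w ++ [i]) := by
    obtain ⟨h₁, h₂⟩ := isReducedWord_reducedWord n w
    refine ⟨?_, by rw [length_mul_right_of_lt i h, List.length_append, h₂]; rfl⟩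
    unfold IsWordFor at *
    rw [List.map_append, List.prod_append, h₁]
    simp
  rw [T_eq_of_isReducedWord K q n hr, List.map_append, List.prod_append]
  simp [T]

theorem T_mul_gen_of_gt (i : Fin (n - 1)) {w : Equiv.Perm (Fin n)}
    (h : w (hi i) < w (lo i)) :
    T K q n w * gen K q n i
      = (q - 1) • T K q n w + q • T K q n (w * simpleTransposition n i) := by
  have := T_mul_gen_of_lt K q i (w := w * simpleTransposition n i)
    (by simpa [Equiv.Perm.mul_apply] using h)
  rw [mul_assoc, simpleTransposition_mul_self, mul_one] at this
  rw [← this, mul_assoc, gen_mul_self, mul_add, mul_smul_comm, mul_smul_comm, mul_one]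

end StandardElements

/-! ### Parabolic subgroups of intervals -/

/-- The `i`-th basic transposition permutes the interval `[a, b]`. -/
def InBlock {n : ℕ} (a b : ℕ) (i : Fin (n - 1)) : Prop := a ≤ (i : ℕ) + 1 ∧ (i : ℕ) + 2 ≤ b

section IntervalPerms

variable {n a b : ℕ}

theorem mem_intervalPerms {w : Equiv.Perm (Fin n)} :
    w ∈ intervalPerms n a b ↔ ∀ j : Fin n, (j : ℕ) + 1 ∉ Finset.Icc a b → w j = j := by
  simp [intervalPerms]

theorem mul_mem_intervalPerms {w w' : Equiv.Perm (Fin n)} (h : w ∈ intervalPerms n a b)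
    (h' : w' ∈ intervalPerms n a b) : w * w' ∈ intervalPerms n a b := by
  rw [mem_intervalPerms] at *
  intro j hj
  rw [Equiv.Perm.mul_apply, h' j hj, h j hj]

theorem inv_mem_intervalPerms {w : Equiv.Perm (Fin n)} (h : w ∈ intervalPerms n a b) :
    w⁻¹ ∈ intervalPerms n a b := by
  rw [mem_intervalPerms] at *
  intro j hj
  rw [Equiv.Perm.inv_eq_iff_eq, h j hj]

theorem simpleTransposition_mem_intervalPerms {i : Fin (n - 1)} (h : InBlock a b i) :
    simpleTransposition n i ∈ intervalPerms n a b := by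
  rw [mem_intervalPerms]
  intro j hj
  obtain ⟨h₁, h₂⟩ := h
  refine simpleTransposition_of_ne i ?_ ?_ <;> rintro rfl <;> apply hj <;>
    simp only [Finset.mem_Icc, val_lo, val_hi] <;> omega

theorem apply_mem_Icc {w : Equiv.Perm (Fin n)} (h : w ∈ intervalPerms n a b) {j : Fin n}
    (hj : (j : ℕ) + 1 ∈ Finset.Icc a b) : (w j : ℕ) + 1 ∈ Finset.Icc a b := by
  by_contra hc
  have := mem_intervalPerms.1 h _ hc
  rw [w.injective this] at hc
  exact hc hj

/-- Points outside the interval are fixed and the interval is preserved, so adjacent points can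
change order only if both lie inside. -/
theorem inBlock_of_gt {w : Equiv.Perm (Fin n)} (h : w ∈ intervalPerms n a b) {i : Fin (n - 1)}
    (hgt : w⁻¹ (hi i) < w⁻¹ (lo i)) : InBlock a b i := by
  have hw := inv_mem_intervalPerms h
  have hlo := mem_intervalPerms.1 hw (lo i)
  have hhi := mem_intervalPerms.1 hw (hi i)
  have hlo' := apply_mem_Icc hw (j := lo i)
  have hhi' := apply_mem_Icc hw (j := hi i)
  rw [Fin.ext_iff] at hlo hhi
  rw [Fin.lt_def] at hgt
  simp only [Finset.mem_Icc, val_lo, val_hi] at *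
  unfold InBlock
  omega

/-- Every descent of an element of `W_R` belongs to the block, so a reduced expression taken in the
whole group uses only generators of the block. -/
theorem intervalPerms_induction {P : Equiv.Perm (Fin n) → Prop} (one : P 1)
    (step : ∀ (i : Fin (n - 1)) (w : Equiv.Perm (Fin n)), InBlock a b i →
      w⁻¹ (lo i) < w⁻¹ (hi i) → P w → P (simpleTransposition n i * w))
    {w : Equiv.Perm (Fin n)} (hw : w ∈ intervalPerms n a b) : P w := by
  induction hk : length n w using Nat.strong_induction_on generalizing w with
  | _ k ih =>
  by_cases h : ∀ i : Fin (n - 1), w⁻¹ (lo i) < w⁻¹ (hi i)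
  · rwa [eq_one_of_forall_lt h]
  · push Not at h
    obtain ⟨i, hle⟩ := h
    have hgt := (inv_lo_lt_or_gt i w).resolve_left hle.not_gt
    have hb := inBlock_of_gt hw hgt
    have hl := length_mul_of_gt i hgt
    have := step i (simpleTransposition n i * w) hb
      (by rwa [inv_mul_apply_lo, inv_mul_apply_hi])
      (ih _ (by omega) (mul_mem_intervalPerms (simpleTransposition_mem_intervalPerms hb) hw) rfl)
    rwa [simpleTransposition_mul_cancel] at this

end IntervalPerms

/-! ### The Poincaré polynomial of an interval subgroup. -/

theorem qFactorial_succ {K : Type*} [Field K] (u : K) (k : ℕ) :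
    qFactorial u (k + 1) = qFactorial u k * ∑ i ∈ Finset.range (k + 1), u ^ i := by
  rw [qFactorial, Finset.prod_Icc_succ_top (by omega)]
  rfl

/-- The Poincaré polynomial of the symmetric group. -/
theorem sum_pow_length {K : Type*} [Field K] (u : K) {n : ℕ} (c m : ℕ) (h : c + m ≤ n) :
    ∑ w ∈ intervalPerms n (c + 1) (c + m), u ^ length n w = qFactorial u m := by
  induction m with
  | zero =>
    have : intervalPerms n (c + 1) (c + 0) = {1} := by
      ext w
      rw [mem_intervalPerms, Finset.mem_singleton]
      refine ⟨fun hw => Equiv.ext fun j => hw j ?_, ?_⟩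
      · simp only [Finset.mem_Icc]
        omega
      · rintro rfl j _
        rfl
    rw [this]
    simp [qFactorial]
  | succ m ih =>
    -- The last place of the interval. The group is fibred by the distance `j` of the image of `top`
    -- from the end; the fibre of `j` will contribute `u ^ j` times the polynomial of the shorter
    -- interval.
    let top : Fin n := ⟨c + m, by omega⟩
    have htop : (top : ℕ) = c + m := rfl
    have hbound : ∀ w ∈ intervalPerms n (c + 1) (c + (m + 1)),
        c ≤ (w top : ℕ) ∧ (w top : ℕ) ≤ c + m := by
      intro w hw
      have := apply_mem_Icc hw (j := top) (by simp only [Finset.mem_Icc, htop]; omega)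
      simp only [Finset.mem_Icc] at this
      omega
    have hmaps : ∀ w ∈ intervalPerms n (c + 1) (c + (m + 1)),
        c + m - (w top : ℕ) ∈ Finset.range (m + 1) := by
      intro w hw
      have := hbound w hw
      rw [Finset.mem_range]
      omega
    rw [← Finset.sum_fiberwise_of_maps_to hmaps, qFactorial_succ, Finset.mul_sum]
    refine Finset.sum_congr rfl fun j hj => ?_
    rw [Finset.mem_range] at hj
    induction j with
    | zero =>
      -- The fibre of `0` is the stabiliser of `top`, the group of the interval shortened by one.
      rw [← ih (by omega), pow_zero, mul_one]
      refine Finset.sum_congr ?_ fun _ _ => rfl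
      ext w
      rw [Finset.mem_filter]
      constructor
      · rintro ⟨hw, h₀⟩
        have hb := hbound w hw
        rw [mem_intervalPerms] at hw ⊢
        intro j hj
        by_cases hjt : j = top
        · subst hjt
          exact Fin.ext (by omega)
        · refine hw j ?_
          rw [Fin.ext_iff] at hjt
          simp only [Finset.mem_Icc] at *
          omega
      · intro hw
        have ht := mem_intervalPerms.1 hw top (by simp only [Finset.mem_Icc, htop]; omega)
        refine ⟨mem_intervalPerms.2 fun j hj => mem_intervalPerms.1 hw j ?_, by rw [ht]; omega⟩
        simp only [Finset.mem_Icc] at *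
        omega
    | succ j ihj =>
      rw [pow_succ, ← mul_assoc, ← ihj (by omega), Finset.sum_mul]
      -- Left multiplication by this transposition moves the image of `top` one place towards the
      -- end. It thus maps the fibre of `j + 1` to that of `j`, and it shortens `w`, since `top` is
      -- the largest point of the interval.
      let i : Fin (n - 1) := ⟨c + m - (j + 1), by omega⟩
      have hiv : (i : ℕ) = c + m - (j + 1) := rfl
      have hblock : InBlock (c + 1) (c + (m + 1)) i := by
        unfold InBlock
        omega
      have hs := simpleTransposition_mem_intervalPerms hblock
      refine Finset.sum_bij' (fun w _ => simpleTransposition n i * w)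
        (fun w _ => simpleTransposition n i * w) ?_ ?_ ?_ ?_ ?_
      · intro w hw
        rw [Finset.mem_filter] at hw ⊢
        have hb := hbound w hw.1
        have : w top = lo i := Fin.ext (by rw [val_lo]; omega)
        refine ⟨mul_mem_intervalPerms hs hw.1, ?_⟩
        rw [Equiv.Perm.mul_apply, this, simpleTransposition_lo, val_hi]
        omega
      · intro w hw
        rw [Finset.mem_filter] at hw ⊢
        have hb := hbound w hw.1
        have : w top = hi i := Fin.ext (by rw [val_hi]; omega)
        refine ⟨mul_mem_intervalPerms hs hw.1, ?_⟩
        rw [Equiv.Perm.mul_apply, this, simpleTransposition_hi, val_lo]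
        omega
      · intro w _
        exact simpleTransposition_mul_cancel i w
      · intro w _
        exact simpleTransposition_mul_cancel i w
      · intro w hw
        rw [Finset.mem_filter] at hw
        have hb := hbound w hw.1
        have ht : w top = lo i := Fin.ext (by rw [val_lo]; omega)
        have hgt : w⁻¹ (hi i) < w⁻¹ (lo i) := by
          have h₁ : w⁻¹ (lo i) = top := by rw [Equiv.Perm.inv_eq_iff_eq, ht]
          have h₂ : w⁻¹ (hi i) ≠ top := fun h => lo_ne_hi i (w⁻¹.injective (h₁.trans h.symm))
          have h₃ := apply_mem_Icc (inv_mem_intervalPerms hw.1) (j := hi i)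
            (by simp only [Finset.mem_Icc, val_hi]; omega)
          rw [h₁, Fin.lt_def]
          rw [Ne, Fin.ext_iff] at h₂
          simp only [Finset.mem_Icc] at h₃
          omega
        rw [← pow_succ, length_mul_of_gt i hgt]

/-! ### Symmetrizers and antisymmetrizers of intervals -/

section BlockSum

variable (K : Type*) [Field K] (q : K) (n : ℕ)

/-- The common form of the elements `x_R` (for `μ = q`) and `y_R` (for `μ = -1`). -/
noncomputable def blockSum (μ : K) (a b : ℕ) : HeckeAlgebra K q n :=
  ∑ w ∈ intervalPerms n a b, (μ * q⁻¹) ^ length n w • T K q n w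

theorem x_eq_blockSum (hq : q ≠ 0) (a b : ℕ) : x K q n a b = blockSum K q n q a b := by
  simp [x, blockSum, mul_inv_cancel₀ hq]

theorem y_eq_blockSum (a b : ℕ) : y K q n a b = blockSum K q n (-1) a b := by
  simp only [y, blockSum, zpow_neg, zpow_natCast]
  refine Finset.sum_congr rfl fun w _ => ?_
  rw [← inv_pow, inv_neg, neg_one_mul]

variable {K q n} {a b : ℕ} {μ : K}

/-- With `t = μ / q`, these are the coefficient identities that make `T_i - μ` kill `T_w + t T_{s_i
w}` when `s_i` lengthens `w`. -/
theorem mul_inv_relations (hq : q ≠ 0) (hμ : μ * μ = (q - 1) * μ + q) :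
    μ * q⁻¹ * q = μ ∧ 1 + μ * q⁻¹ * (q - 1) - μ * (μ * q⁻¹) = 0 := by
  refine ⟨inv_mul_cancel_right₀ hq μ, ?_⟩
  linear_combination (-q⁻¹) * hμ - mul_inv_cancel₀ hq

/-- The terms of `w` and `s_i w` pair off, and `T_i - μ` annihilates each pair because `μ` is a root
of the quadratic relation. -/
theorem gen_mul_blockSum (hq : q ≠ 0) (hμ : μ * μ = (q - 1) * μ + q) {i : Fin (n - 1)}
    (hi : InBlock a b i) : gen K q n i * blockSum K q n μ a b = μ • blockSum K q n μ a b := by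
  rw [← sub_eq_zero, blockSum, Finset.mul_sum, Finset.smul_sum, ← Finset.sum_sub_distrib]
  have hpair : ∀ w : Equiv.Perm (Fin n), w⁻¹ (lo i) < w⁻¹ (IwahoriHecke.hi i) →
      gen K q n i * (μ * q⁻¹) ^ length n w • T K q n w
        - μ • (μ * q⁻¹) ^ length n w • T K q n w
      + (gen K q n i * (μ * q⁻¹) ^ length n (simpleTransposition n i * w) •
          T K q n (simpleTransposition n i * w)
        - μ • (μ * q⁻¹) ^ length n (simpleTransposition n i * w) •
          T K q n (simpleTransposition n i * w)) = 0 := by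
    intro w hw
    have h := gen_mul_T_of_gt K q i (w := simpleTransposition n i * w)
      (by rwa [inv_mul_apply_hi, inv_mul_apply_lo])
    rw [simpleTransposition_mul_cancel] at h
    rw [mul_smul_comm, mul_smul_comm, gen_mul_T_of_lt K q i hw, h, length_mul_of_lt i hw]
    obtain ⟨h₁, h₂⟩ := mul_inv_relations hq hμ
    generalize μ * q⁻¹ = t at *
    match_scalars
    · linear_combination t ^ length n w * h₂
    · linear_combination t ^ length n w * h₁
  refine Finset.sum_involution (fun w _ => simpleTransposition n i * w) ?_ ?_ ?_ ?_
  · intro w _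
    rcases inv_lo_lt_or_gt i w with h | h
    · exact hpair w h
    · have := hpair (simpleTransposition n i * w) (by rwa [inv_mul_apply_lo, inv_mul_apply_hi])
      rw [simpleTransposition_mul_cancel] at this
      rwa [add_comm]
  · intro w _ _ h
    rw [mul_eq_right] at h
    have := congrArg (fun σ => σ (lo i)) h
    rw [simpleTransposition_lo] at this
    exact lo_ne_hi i this.symm
  · intro w hw
    exact mul_mem_intervalPerms (simpleTransposition_mem_intervalPerms hi) hw
  · intro w _
    exact simpleTransposition_mul_cancel i w

theorem blockSum_mul_gen (hq : q ≠ 0) (hμ : μ * μ = (q - 1) * μ + q) {i : Fin (n - 1)}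
    (hi : InBlock a b i) : blockSum K q n μ a b * gen K q n i = μ • blockSum K q n μ a b := by
  rw [← sub_eq_zero, blockSum, Finset.sum_mul, Finset.smul_sum, ← Finset.sum_sub_distrib]
  have hcancel : ∀ w : Equiv.Perm (Fin n),
      w * simpleTransposition n i * simpleTransposition n i = w := fun w => by
    rw [mul_assoc, simpleTransposition_mul_self, mul_one]
  have hpair : ∀ w : Equiv.Perm (Fin n), w (lo i) < w (IwahoriHecke.hi i) →
      (μ * q⁻¹) ^ length n w • T K q n w * gen K q n i
        - μ • (μ * q⁻¹) ^ length n w • T K q n w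
      + ((μ * q⁻¹) ^ length n (w * simpleTransposition n i) •
          T K q n (w * simpleTransposition n i) * gen K q n i
        - μ • (μ * q⁻¹) ^ length n (w * simpleTransposition n i) •
          T K q n (w * simpleTransposition n i)) = 0 := by
    intro w hw
    have h := T_mul_gen_of_gt K q i (w := w * simpleTransposition n i)
      (by simpa [Equiv.Perm.mul_apply] using hw)
    rw [hcancel] at h
    rw [smul_mul_assoc, smul_mul_assoc, T_mul_gen_of_lt K q i hw, h, length_mul_right_of_lt i hw]
    obtain ⟨h₁, h₂⟩ := mul_inv_relations hq hμ
    generalize μ * q⁻¹ = t at *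
    match_scalars
    · linear_combination t ^ length n w * h₂
    · linear_combination t ^ length n w * h₁
  refine Finset.sum_involution (fun w _ => w * simpleTransposition n i) ?_ ?_ ?_ ?_
  · intro w _
    rcases lt_or_gt_of_ne (w.injective.ne (lo_ne_hi i)) with h | h
    · exact hpair w h
    · have := hpair (w * simpleTransposition n i) (by simpa [Equiv.Perm.mul_apply] using h)
      rw [hcancel] at this
      rwa [add_comm]
  · intro w _ _ h
    rw [mul_eq_left] at h
    have := congrArg (fun σ => σ (lo i)) h
    rw [simpleTransposition_lo] at this
    exact lo_ne_hi i this.symm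
  · intro w hw
    exact mul_mem_intervalPerms hw (simpleTransposition_mem_intervalPerms hi)
  · intro w _
    exact hcancel w

theorem rep_T_apply {M : Type*} [AddCommGroup M] [Module K M]
    (ρ : HeckeAlgebra K q n →ₐ[K] Module.End K M) {f : M}
    (hf : ∀ i, InBlock a b i → ρ (gen K q n i) f = μ • f) {w : Equiv.Perm (Fin n)}
    (hw : w ∈ intervalPerms n a b) : ρ (T K q n w) f = μ ^ length n w • f := by
  refine intervalPerms_induction (P := fun w => ρ (T K q n w) f = μ ^ length n w • f) ?_ ?_ hw
  · simp [T_one]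
  · intro i w hb hlt ih
    rw [← gen_mul_T_of_lt K q i hlt, map_mul, Module.End.mul_apply, ih, map_smul, hf i hb,
      length_mul_of_lt i hlt, pow_succ, mul_smul]

/-- Each `T_w` acts on `f` by `μ ^ l(w)` and carries the weight `(μ q⁻¹) ^ l(w)`, so the scalar is
the Poincaré polynomial at `μ² q⁻¹`. This is `q` for `μ = q` and `q⁻¹` for `μ = -1`, whence the two
kinds of factorials in `c_r`. -/
theorem rep_blockSum_apply {M : Type*} [AddCommGroup M] [Module K M]
    (ρ : HeckeAlgebra K q n →ₐ[K] Module.End K M) {c m : ℕ} (h : c + m ≤ n) {f : M}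
    (hf : ∀ i, InBlock (c + 1) (c + m) i → ρ (gen K q n i) f = μ • f) :
    ρ (blockSum K q n μ (c + 1) (c + m)) f = qFactorial (μ * μ * q⁻¹) m • f := by
  rw [blockSum, map_sum, LinearMap.sum_apply, ← sum_pow_length _ c m h, Finset.sum_smul]
  refine Finset.sum_congr rfl fun w hw => ?_
  rw [map_smul, LinearMap.smul_apply, rep_T_apply ρ hf hw, smul_smul, ← mul_pow]
  congr 2
  ring

theorem blockSum_mem_adjoin :
    blockSum K q n μ a b ∈ Algebra.adjoin K (gen K q n '' {i | InBlock a b i}) := by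
  refine Subalgebra.sum_mem _ fun w hw => Subalgebra.smul_mem _ ?_ _
  refine intervalPerms_induction
    (P := fun w => T K q n w ∈ Algebra.adjoin K (gen K q n '' {i | InBlock a b i})) ?_ ?_ hw
  · rw [T_one]
    exact one_mem _
  · intro i w hb hlt ih
    rw [← gen_mul_T_of_lt K q i hlt]
    exact mul_mem (Algebra.subset_adjoin ⟨i, hb, rfl⟩) ih

theorem commute_blockSum {ν : K} {a' b' : ℕ} (h : b < a') :
    Commute (blockSum K q n μ a b) (blockSum K q n ν a' b') := by
  refine Algebra.commute_of_mem_adjoin_of_forall_mem_commute (R := K) blockSum_mem_adjoin ?_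
  rintro _ ⟨i, ⟨hi₁, hi₂⟩, rfl⟩
  refine (Algebra.commute_of_mem_adjoin_of_forall_mem_commute (R := K) blockSum_mem_adjoin ?_).symm
  rintro _ ⟨j, ⟨hj₁, hj₂⟩, rfl⟩
  exact gen_comm K q n i j (Or.inr (by omega))

/-- A shared generator inserted between the factors acts by `μ` on the left one and by `ν` on the
right one. -/
theorem blockSum_mul_blockSum_eq_zero {ν : K} {a' b' : ℕ} (hq : q ≠ 0)
    (hμ : μ * μ = (q - 1) * μ + q) (hν : ν * ν = (q - 1) * ν + q) (hne : μ ≠ ν)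
    {i : Fin (n - 1)} (h : InBlock a b i) (h' : InBlock a' b' i) :
    blockSum K q n μ a b * blockSum K q n ν a' b' = 0 := by
  have h₁ : μ • (blockSum K q n μ a b * blockSum K q n ν a' b')
      = ν • (blockSum K q n μ a b * blockSum K q n ν a' b') := by
    rw [← smul_mul_assoc, ← blockSum_mul_gen hq hμ h, mul_assoc, gen_mul_blockSum hq hν h',
      mul_smul_comm]
  rw [← sub_eq_zero, ← sub_smul] at h₁
  exact (smul_eq_zero.1 h₁).resolve_left (sub_ne_zero.2 hne)

end BlockSum

/-! ### The representation on functions of two-coloured words -/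

section WordModule

variable {K : Type*} [Field K] (q : K) {n : ℕ} (lam : Bool → K)

/-- The two values are the two roots `q`, `-1` of the quadratic relation. -/
def IsEigenvaluePair (q : K) (lam : Bool → K) : Prop :=
  (lam false = q ∧ lam true = -1) ∨ (lam false = -1 ∧ lam true = q)

/-- The word obtained from `w` by exchanging the letters at the places `i` and `i + 1`. -/
def swapWord (i : Fin (n - 1)) (w : Fin n → Bool) : Fin n → Bool := w ∘ simpleTransposition n i

@[simp] theorem swapWord_lo (i : Fin (n - 1)) (w : Fin n → Bool) :
    swapWord i w (lo i) = w (hi i) := by simp [swapWord]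

@[simp] theorem swapWord_hi (i : Fin (n - 1)) (w : Fin n → Bool) :
    swapWord i w (hi i) = w (lo i) := by simp [swapWord]

theorem swapWord_of_ne (i : Fin (n - 1)) (w : Fin n → Bool) {a : Fin n} (h₁ : a ≠ lo i)
    (h₂ : a ≠ hi i) : swapWord i w a = w a := by
  simp [swapWord, simpleTransposition_of_ne i h₁ h₂]

@[simp] theorem swapWord_swapWord (i : Fin (n - 1)) (w : Fin n → Bool) :
    swapWord i (swapWord i w) = w := by
  funext a
  simp [swapWord]

theorem swapWord_eq_self (i : Fin (n - 1)) {w : Fin n → Bool} (h : w (lo i) = w (hi i)) :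
    swapWord i w = w := by
  funext a
  by_cases h₁ : a = lo i
  · rw [h₁, swapWord_lo, h]
  · by_cases h₂ : a = hi i
    · rw [h₂, swapWord_hi, h]
    · exact swapWord_of_ne i w h₁ h₂

theorem swapWord_comm {i j : Fin (n - 1)} (h : (i : ℕ) + 2 ≤ j) (w : Fin n → Bool) :
    swapWord i (swapWord j w) = swapWord j (swapWord i w) := by
  have := simpleTransposition_comm i j h
  funext a
  exact congrArg w (DFunLike.congr_fun this.symm a)

theorem swapWord_braid {i j : Fin (n - 1)} (h : (i : ℕ) + 1 = j) (w : Fin n → Bool) :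
    swapWord i (swapWord j (swapWord i w)) = swapWord j (swapWord i (swapWord j w)) := by
  have := simpleTransposition_braid i j h
  funext a
  exact congrArg w (DFunLike.congr_fun this a)

/-- The diagonal coefficient of `T_i` at the word `w`. -/
def diagCoeff (i : Fin (n - 1)) (w : Fin n → Bool) : K :=
  if w (lo i) = w (hi i) then lam (w (lo i)) else if w (lo i) then q - 1 else 0

/-- The off-diagonal coefficient of `T_i` at the word `w`. -/
def offCoeff (i : Fin (n - 1)) (w : Fin n → Bool) : K :=
  if w (lo i) = w (hi i) then 0 else if w (lo i) then 1 else q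

/-- The action of `T_i` on functions of words. -/
def act (i : Fin (n - 1)) : Module.End K ((Fin n → Bool) → K) where
  toFun f w := diagCoeff q lam i w * f w + offCoeff q i w * f (swapWord i w)
  map_add' f g := by
    funext w
    simp only [Pi.add_apply]
    ring
  map_smul' c f := by
    funext w
    simp only [Pi.smul_apply, smul_eq_mul, RingHom.id_apply]
    ring

theorem act_apply (i : Fin (n - 1)) (f : (Fin n → Bool) → K) (w : Fin n → Bool) :
    act q lam i f w = diagCoeff q lam i w * f w + offCoeff q i w * f (swapWord i w) := rfl

theorem act_quad (hlam : IsEigenvaluePair q lam) (i : Fin (n - 1)) :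
    act q lam i * act q lam i = (q - 1) • act q lam i + q • 1 := by
  refine LinearMap.ext fun f => funext fun w => ?_
  simp only [Module.End.mul_apply, act_apply, LinearMap.add_apply, LinearMap.smul_apply,
    Pi.add_apply, Pi.smul_apply, smul_eq_mul, Module.End.one_apply, diagCoeff, offCoeff,
    swapWord_lo, swapWord_hi, swapWord_swapWord]
  rcases hlam with ⟨h₁, h₂⟩ | ⟨h₁, h₂⟩ <;> rcases w (lo i) <;> rcases w (hi i) <;>
    simp only [h₁, h₂, if_true, if_false, reduceCtorEq, Bool.false_eq_true] <;> ring

theorem act_comm {i j : Fin (n - 1)} (h : (i : ℕ) + 2 ≤ j) :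
    act q lam i * act q lam j = act q lam j * act q lam i := by
  have h₁ : (lo j : Fin n) ≠ lo i := by simp [Fin.ext_iff]; omega
  have h₂ : (lo j : Fin n) ≠ hi i := by simp [Fin.ext_iff]; omega
  have h₃ : (hi j : Fin n) ≠ lo i := by simp [Fin.ext_iff]; omega
  have h₄ : (hi j : Fin n) ≠ hi i := by simp [Fin.ext_iff]; omega
  refine LinearMap.ext fun f => funext fun w => ?_
  simp only [Module.End.mul_apply, act_apply, diagCoeff, offCoeff, swapWord_of_ne i _ h₁ h₂,
    swapWord_of_ne i _ h₃ h₄, swapWord_of_ne j _ h₁.symm h₃.symm,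
    swapWord_of_ne j _ h₂.symm h₄.symm, swapWord_comm h]
  ring

theorem act_braid (hlam : IsEigenvaluePair q lam) {i j : Fin (n - 1)} (h : (i : ℕ) + 1 = j) :
    act q lam i * act q lam j * act q lam i = act q lam j * act q lam i * act q lam j := by
  have hp : (lo j : Fin n) = hi i := Fin.ext h.symm
  have h₁ : (hi j : Fin n) ≠ lo i := by simp [Fin.ext_iff]; omega
  have h₂ : (hi j : Fin n) ≠ hi i := by simp [Fin.ext_iff]; omega
  have h₃ : (lo i : Fin n) ≠ lo j := by simp [Fin.ext_iff]; omega
  have e₁ : ∀ w, swapWord j w (hi i) = w (hi j) := fun w => by rw [← hp, swapWord_lo]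
  have e₂ : ∀ w, swapWord j w (hi j) = w (hi i) := fun w => by rw [swapWord_hi, hp]
  refine LinearMap.ext fun f => funext fun w => ?_
  simp only [Module.End.mul_apply, act_apply, diagCoeff, offCoeff, hp, swapWord_lo, swapWord_hi,
    swapWord_of_ne i _ h₁ h₂, swapWord_of_ne j _ h₃ h₁.symm, e₁, e₂, swapWord_swapWord]
  have hb := swapWord_braid h w
  rcases hlam with ⟨hf, ht⟩ | ⟨hf, ht⟩ <;> rcases w (lo i) <;> rcases w (hi i) <;>
    rcases w (hi j) <;>
    simp only [hf, ht, if_true, if_false, reduceCtorEq, Bool.false_eq_true, hb] <;> ring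

/-- The representation of the Hecke algebra on functions of words. -/
noncomputable def wordRep (hlam : IsEigenvaluePair q lam) :
    HeckeAlgebra K q n →ₐ[K] Module.End K ((Fin n → Bool) → K) :=
  lift (act q lam) (fun _ _ => act_braid q lam hlam) (fun _ _ => act_comm q lam)
    (act_quad q lam hlam)

theorem wordRep_gen (hlam : IsEigenvaluePair q lam) (i : Fin (n - 1)) :
    wordRep q lam hlam (gen K q n i) = act q lam i := lift_gen _ _ _ _ i

/-- In terms of delta functions: `T_i δ_w` is `δ_{sw}` if the letters are `false, true`, and `(q -
1) δ_w + q δ_{sw}` if they are `true, false`. These are the rules for the elements `T_d e` with `d`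
a minimal coset representative. -/
theorem act_single (i : Fin (n - 1)) (w : Fin n → Bool) :
    act q lam i (Pi.single w 1) = diagCoeff q lam i w • Pi.single w 1
      + offCoeff q i (swapWord i w) • Pi.single (swapWord i w) 1 := by
  funext w'
  simp only [act_apply, Pi.add_apply, Pi.smul_apply, smul_eq_mul, Pi.single_apply]
  have h₁ : swapWord i w' = w ↔ w' = swapWord i w := by
    constructor <;> rintro rfl <;> simp
  by_cases h : w' = w
  · subst h
    simp only [h₁]
    by_cases h' : w' = swapWord i w'
    · rw [← h']
    · simp [h']
  · by_cases h' : w' = swapWord i w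
    · subst h'
      simp [h]
    · simp [h, h', h₁]

/-- The weakly increasing word with `k` letters `false`. -/
def sortedWord (n k : ℕ) (p : Fin n) : Bool := decide (k ≤ (p : ℕ))

theorem sortedWord_eq_true {k : ℕ} {p : Fin n} : sortedWord n k p = true ↔ k ≤ (p : ℕ) :=
  decide_eq_true_iff

theorem sortedWord_eq_false {k : ℕ} {p : Fin n} : sortedWord n k p = false ↔ (p : ℕ) < k := by
  rw [← Bool.not_eq_true, sortedWord_eq_true, not_le]

theorem sortedWord_monotone (k : ℕ) : Monotone (sortedWord n k) := by
  intro a b hab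
  rw [Bool.le_iff_imp]
  rw [sortedWord_eq_true, sortedWord_eq_true]
  rw [Fin.le_def] at hab
  omega

theorem sort_sortedWord (k : ℕ) : Tuple.sort (sortedWord n k) = 1 :=
  Tuple.sort_eq_refl_iff_monotone.2 (sortedWord_monotone k)

/-- The word `w` is a rearrangement of the sorted word with `k` letters `false`. -/
def HasContent (k : ℕ) (w : Fin n → Bool) : Prop := w ∘ Tuple.sort w = sortedWord n k

theorem hasContent_sortedWord (k : ℕ) : HasContent k (sortedWord n k) := by
  rw [HasContent, sort_sortedWord]
  rfl

theorem hasContent_swapWord {k : ℕ} {i : Fin (n - 1)} {w : Fin n → Bool} :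
    HasContent k (swapWord i w) ↔ HasContent k w := by
  rw [HasContent, HasContent, swapWord, Tuple.comp_perm_comp_sort_eq_comp_sort]

/-- The functions supported on the words with `k` letters `false`. -/
def contentSubmodule (K : Type*) [Field K] (n k : ℕ) : Submodule K ((Fin n → Bool) → K) where
  carrier := {f | ∀ w, ¬ HasContent k w → f w = 0}
  add_mem' := fun hf hg w hw => by rw [Pi.add_apply, hf w hw, hg w hw, add_zero]
  zero_mem' := fun _ _ => rfl
  smul_mem' := fun c f hf w hw => by rw [Pi.smul_apply, hf w hw, smul_zero]

theorem act_mem_contentSubmodule {k : ℕ} (i : Fin (n - 1)) {f : (Fin n → Bool) → K}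
    (hf : f ∈ contentSubmodule K n k) : act q lam i f ∈ contentSubmodule K n k := by
  intro w hw
  rw [act_apply, hf w hw, hf _ (mt hasContent_swapWord.1 hw), mul_zero, mul_zero, add_zero]

variable {q lam}

theorem heckeAlgebra_induction {P : HeckeAlgebra K q n → Prop}
    (gen : ∀ i, P (gen K q n i)) (scalar : ∀ c : K, P (algebraMap K _ c))
    (add : ∀ a b, P a → P b → P (a + b)) (mul : ∀ a b, P a → P b → P (a * b))
    (h : HeckeAlgebra K q n) : P h := by
  have hh : h ∈ Algebra.adjoin K (Set.range (IwahoriHecke.gen K q n)) := by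
    rw [adjoin_range_gen]
    exact Algebra.mem_top
  induction hh using Algebra.adjoin_induction with
  | mem x hx =>
    obtain ⟨i, rfl⟩ := hx
    exact gen i
  | algebraMap c => exact scalar c
  | add a b _ _ ha hb => exact add a b ha hb
  | mul a b _ _ ha hb => exact mul a b ha hb

theorem wordRep_mem_contentSubmodule (hlam : IsEigenvaluePair q lam) {k : ℕ}
    (h : HeckeAlgebra K q n) {f : (Fin n → Bool) → K} (hf : f ∈ contentSubmodule K n k) :
    wordRep q lam hlam h f ∈ contentSubmodule K n k := by
  induction h using heckeAlgebra_induction generalizing f with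
  | gen i =>
    rw [wordRep_gen]
    exact act_mem_contentSubmodule q lam i hf
  | scalar c =>
    rw [AlgHom.commutes, Module.algebraMap_end_apply]
    exact Submodule.smul_mem _ c hf
  | add a b ha hb =>
    rw [map_add]
    exact Submodule.add_mem _ (ha hf) (hb hf)
  | mul a b ha hb =>
    rw [map_mul]
    exact ha (hb hf)

theorem single_sortedWord_mem (k : ℕ) :
    (Pi.single (sortedWord n k) 1 : (Fin n → Bool) → K) ∈ contentSubmodule K n k := by
  intro w hw
  refine Pi.single_eq_of_ne (fun h => hw ?_) 1
  rw [h]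
  exact hasContent_sortedWord k

/-- The submodule of functions on words of given content is generated by the sorted word. -/
theorem exists_wordRep_eq (hlam : IsEigenvaluePair q lam) (hq : q ≠ 0) {k : ℕ}
    {f : (Fin n → Bool) → K} (hf : f ∈ contentSubmodule K n k) :
    ∃ h, wordRep q lam hlam h (Pi.single (sortedWord n k) 1) = f := by
  let N : Submodule K ((Fin n → Bool) → K) := LinearMap.range
    ((LinearMap.applyₗ (Pi.single (sortedWord n k) 1)).comp (wordRep q lam hlam).toLinearMap)
  have hN : ∀ g, g ∈ N ↔ ∃ h, wordRep q lam hlam h (Pi.single (sortedWord n k) 1) = g :=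
    fun g => Iff.rfl
  have hact : ∀ i g, g ∈ N → act q lam i g ∈ N := by
    intro i g hg
    obtain ⟨h, rfl⟩ := (hN g).1 hg
    refine (hN _).2 ⟨gen K q n i * h, ?_⟩
    rw [map_mul, wordRep_gen]
    rfl
  -- Modulo the delta function of `w`, the generator yields that of the swapped word with
  -- coefficient `1` or `q`, which is invertible.
  have hswap : ∀ i w, Pi.single w 1 ∈ N → Pi.single (swapWord i w) 1 ∈ N := by
    intro i w hw
    by_cases h : w (lo i) = w (hi i)
    · rwa [swapWord_eq_self i h]
    · have h₁ := hact i _ hw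
      rw [act_single] at h₁
      have h₂ := (Submodule.add_mem_iff_right N (N.smul_mem _ hw)).1 h₁
      refine (Submodule.smul_mem_iff N ?_).1 h₂
      rw [offCoeff, swapWord_lo, swapWord_hi, if_neg (Ne.symm h)]
      split_ifs
      · exact one_ne_zero
      · exact hq
  have hlist : ∀ (v : List (Fin (n - 1))) (w : Fin n → Bool), Pi.single w 1 ∈ N →
      Pi.single (w ∘ (v.map (simpleTransposition n)).prod) 1 ∈ N := by
    intro v
    induction v with
    | nil => exact fun w hw => hw
    | cons i v ih => exact fun w hw => ih _ (hswap i w hw)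
  rw [← hN, ← Finset.univ_sum_single f]
  refine Submodule.sum_mem _ fun w _ => ?_
  by_cases hw : HasContent k w
  -- The inverse of the sorting permutation rearranges the sorted word into `w`; follow an
  -- expression of it by basic transpositions.
  · obtain ⟨v, hv⟩ := exists_isWordFor n (Tuple.sort w)⁻¹
    have h₁ := hlist v (sortedWord n k) ((hN _).2 ⟨1, by rw [map_one]; rfl⟩)
    rw [hv, ← hw] at h₁
    have h₂ : (w ∘ Tuple.sort w) ∘ ⇑(Tuple.sort w)⁻¹ = w := by
      funext a
      simp
    rw [h₂] at h₁
    have := N.smul_mem (f w) h₁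
    rwa [← Pi.single_smul, smul_eq_mul, mul_one] at this
  · rw [hf w hw, Pi.single_zero]
    exact N.zero_mem

end WordModule

section Corner

variable {K : Type*} [Field K] {q : K} {n : ℕ} {lam : Bool → K}

/-! ### The isomorphism between a left ideal and the module of words -/

/-- Stable sorting is characterised by keeping equal letters in order, and exchanging two adjacent
different letters does not affect the order among equal ones. -/
theorem sort_swapWord {i : Fin (n - 1)} {w : Fin n → Bool} (h : w (lo i) ≠ w (hi i)) :
    Tuple.sort (swapWord i w) = simpleTransposition n i * Tuple.sort w := by
  obtain ⟨hmono, hstab⟩ := (Tuple.eq_sort_iff (f := w)).1 rfl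
  have hval : ∀ a, swapWord i w ((simpleTransposition n i * Tuple.sort w) a)
      = w (Tuple.sort w a) := by
    intro a
    simp [swapWord, Equiv.Perm.mul_apply]
  refine (Tuple.eq_sort_iff.2 ⟨?_, ?_⟩).symm
  · intro a b hab
    rw [Function.comp_apply, Function.comp_apply, hval, hval]
    exact hmono hab
  · intro a b hab heq
    rw [hval, hval] at heq
    refine simpleTransposition_lt i (hstab a b hab heq) ?_
    rintro ⟨h₁, h₂⟩
    rw [h₁, h₂] at heq
    exact h heq

theorem sort_inv_lt {i : Fin (n - 1)} {w : Fin n → Bool} (h₁ : w (lo i) = false)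
    (h₂ : w (hi i) = true) : (Tuple.sort w)⁻¹ (lo i) < (Tuple.sort w)⁻¹ (hi i) := by
  refine (inv_lo_lt_or_gt i _).resolve_right fun h => ?_
  have := Tuple.monotone_sort w h.le
  rw [Function.comp_apply, Function.comp_apply, Equiv.Perm.coe_inv, Equiv.apply_symm_apply,
    Equiv.apply_symm_apply, h₁, h₂] at this
  exact absurd this (by decide)

/-- Anything sorted strictly between two equal neighbours would carry the same letter, and stability
would put its original place strictly between `i` and `i + 1`. -/
theorem sort_inv_succ {i : Fin (n - 1)} {w : Fin n → Bool} (h : w (lo i) = w (hi i)) :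
    (((Tuple.sort w)⁻¹ (hi i) : Fin n) : ℕ) = ((Tuple.sort w)⁻¹ (lo i) : Fin n) + 1 := by
  obtain ⟨hmono, hstab⟩ := (Tuple.eq_sort_iff (f := w)).1 rfl
  have hlt : (Tuple.sort w)⁻¹ (lo i) < (Tuple.sort w)⁻¹ (hi i) := by
    refine (inv_lo_lt_or_gt i _).resolve_right fun hgt => ?_
    have := hstab _ _ hgt (by simp [h])
    simp only [Equiv.Perm.coe_inv, Equiv.apply_symm_apply] at this
    exact this.not_gt (lo_lt_hi i)
  by_contra hne
  rw [Fin.lt_def] at hlt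
  let p : Fin n := ⟨((Tuple.sort w)⁻¹ (lo i) : Fin n) + 1, by omega⟩
  have hp₁ : (Tuple.sort w)⁻¹ (lo i) < p := by simp [Fin.lt_def, p]
  have hp₂ : p < (Tuple.sort w)⁻¹ (hi i) := by
    rw [Fin.lt_def]
    simp only [p]
    omega
  have h₁ := hmono hp₁.le
  have h₂ := hmono hp₂.le
  simp only [Function.comp_apply, Equiv.Perm.coe_inv, Equiv.apply_symm_apply] at h₁ h₂
  rw [← h] at h₂
  have h₃ := hstab _ _ hp₁ (by simpa using le_antisymm h₁ h₂)
  have h₄ := hstab _ _ hp₂ (by simpa [← h] using le_antisymm h₂ h₁)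
  simp only [Equiv.Perm.coe_inv, Equiv.apply_symm_apply] at h₃ h₄
  rw [Fin.lt_def, val_lo] at h₃
  rw [Fin.lt_def, val_hi] at h₄
  omega

open Classical in
/-- The element of the left ideal generated by `e` which corresponds to the word `w`. -/
noncomputable def wordElement (e : HeckeAlgebra K q n) (k : ℕ) (w : Fin n → Bool) :
    HeckeAlgebra K q n :=
  if HasContent k w then T K q n (Tuple.sort w) * e else 0

/-- `f` is an eigenvector of the generators of the two blocks `[1, k]` and `[k + 1, n]`, in a
representation in which the generators act by `t`. -/
def IsBlockEigenvector {M : Type*} [AddCommGroup M] [Module K M]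
    (t : Fin (n - 1) → Module.End K M) (mu : Bool → K) (k : ℕ) (f : M) : Prop :=
  (∀ i, InBlock 1 k i → t i f = mu false • f) ∧
  (∀ i, InBlock (k + 1) n i → t i f = mu true • f)

theorem IsBlockEigenvector.apply_of_eq {M : Type*} [AddCommGroup M] [Module K M]
    {t : Fin (n - 1) → Module.End K M} {mu : Bool → K} {k : ℕ} {f : M}
    (h : IsBlockEigenvector t mu k f) {i : Fin (n - 1)}
    (hi' : sortedWord n k (lo i) = sortedWord n k (hi i)) :
    t i f = mu (sortedWord n k (lo i)) • f := by
  have := i.isLt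
  cases h₁ : sortedWord n k (lo i)
  · have h₂ := hi'.symm.trans h₁
    rw [sortedWord_eq_false, val_hi] at h₂
    exact h.1 i ⟨by omega, by omega⟩
  · rw [sortedWord_eq_true, val_lo] at h₁
    exact h.2 i ⟨by omega, by omega⟩

/-- The action of the generators on the Hecke algebra by left multiplication. -/
noncomputable def leftMul (K : Type*) [Field K] (q : K) (n : ℕ) (i : Fin (n - 1)) :
    Module.End K (HeckeAlgebra K q n) := Algebra.lmul K (HeckeAlgebra K q n) (gen K q n i)

theorem leftMul_apply (i : Fin (n - 1)) (a : HeckeAlgebra K q n) :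
    leftMul K q n i a = gen K q n i * a := rfl

/-- With `d` the sorting permutation of `w`: if the two letters differ, `s_i d` is again a sorting
permutation; if they agree, `s_i d = d s_j` with `s_j` inside a block, and `T_j` acts on `e` by a
scalar. The coefficients are those of `act_single`, which makes `wordMap` linear over the Hecke
algebra. -/
theorem gen_mul_wordElement {e : HeckeAlgebra K q n} {k : ℕ}
    (he : IsBlockEigenvector (leftMul K q n) lam k e) (i : Fin (n - 1)) (w : Fin n → Bool) :
    gen K q n i * wordElement e k w = diagCoeff q lam i w • wordElement e k w
      + offCoeff q i (swapWord i w) • wordElement e k (swapWord i w) := by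
  by_cases hw : HasContent k w
  · have hsw := (hasContent_swapWord (i := i)).2 hw
    rw [wordElement, wordElement, if_pos hw, if_pos hsw, diagCoeff, offCoeff, swapWord_lo,
      swapWord_hi]
    by_cases h : w (lo i) = w (hi i)
    · rw [if_pos h, if_pos h.symm, zero_smul, add_zero]
      have hsucc := sort_inv_succ h
      set p : Fin n := (Tuple.sort w)⁻¹ (lo i) with hp
      set p' : Fin n := (Tuple.sort w)⁻¹ (hi i) with hp'
      have hlt : p < p' := by rw [Fin.lt_def]; omega
      -- The two equal letters occupy the adjacent places `p`, `p'` of the sorted word, so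
      -- conjugation by `d` turns `s_i` into this basic transposition.
      let j : Fin (n - 1) := ⟨p, by have := p'.isLt; omega⟩
      have hj : (lo j : Fin n) = p := rfl
      have hj' : (hi j : Fin n) = p' := Fin.ext hsucc.symm
      have e₁ : Tuple.sort w p = lo i := by simp [hp]
      have e₂ : Tuple.sort w p' = hi i := by simp [hp']
      have hconj : simpleTransposition n i * Tuple.sort w
          = Tuple.sort w * simpleTransposition n j := by
        rw [simpleTransposition_eq, simpleTransposition_eq, hj, hj', Equiv.mul_swap_eq_swap_mul,
          e₁, e₂]
      have s₁ : sortedWord n k (lo j) = w (lo i) := by rw [hj, ← hw, Function.comp_apply, e₁]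
      have s₂ : sortedWord n k (hi j) = w (hi i) := by rw [hj', ← hw, Function.comp_apply, e₂]
      have hev := he.apply_of_eq (i := j) (by rw [s₁, s₂, h])
      rw [leftMul_apply, s₁] at hev
      rw [← mul_assoc, gen_mul_T_of_lt K q i hlt, hconj,
        ← T_mul_gen_of_lt K q j (by rw [hj, hj', e₁, e₂]; exact lo_lt_hi i), mul_assoc, hev,
        mul_smul_comm]
    · rw [if_neg h, if_neg (Ne.symm h), sort_swapWord h, ← mul_assoc]
      cases h₁ : w (lo i) <;> cases h₂ : w (hi i)
      · exact absurd (h₁.trans h₂.symm) h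
      · rw [gen_mul_T_of_lt K q i (sort_inv_lt h₁ h₂)]
        simp
      · have hlt := sort_inv_lt (i := i) (w := swapWord i w) (by rwa [swapWord_lo])
          (by rwa [swapWord_hi])
        rw [sort_swapWord h, inv_mul_apply_lo, inv_mul_apply_hi] at hlt
        rw [gen_mul_T_of_gt K q i hlt, add_mul, smul_mul_assoc, smul_mul_assoc]
        simp
      · exact absurd (h₁.trans h₂.symm) h
  · have hsw := mt (hasContent_swapWord (i := i)).1 hw
    rw [wordElement, wordElement, if_neg hw, if_neg hsw, mul_zero, smul_zero, smul_zero, add_zero]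

/-- The linear map sending the word `w` to the element `wordElement e k w`. -/
noncomputable def wordMap (e : HeckeAlgebra K q n) (k : ℕ) :
    ((Fin n → Bool) → K) →ₗ[K] HeckeAlgebra K q n :=
  Fintype.linearCombination K (wordElement e k)

theorem wordMap_single (e : HeckeAlgebra K q n) (k : ℕ) (w : Fin n → Bool) :
    wordMap e k (Pi.single w 1) = wordElement e k w := by
  rw [wordMap, Fintype.linearCombination_apply_single, one_smul]

theorem wordMap_act {e : HeckeAlgebra K q n} {k : ℕ}
    (he : IsBlockEigenvector (leftMul K q n) lam k e) (i : Fin (n - 1))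
    (f : (Fin n → Bool) → K) :
    wordMap e k (act q lam i f) = gen K q n i * wordMap e k f := by
  have : (wordMap e k).comp (act q lam i) = (leftMul K q n i).comp (wordMap e k) := by
    refine LinearMap.pi_ext' fun w => LinearMap.ext_ring ?_
    simp only [LinearMap.comp_apply, LinearMap.single_apply, act_single, map_add, map_smul,
      wordMap_single, leftMul_apply, gen_mul_wordElement he]
  exact LinearMap.congr_fun this f

theorem wordMap_wordRep (hlam : IsEigenvaluePair q lam) {e : HeckeAlgebra K q n} {k : ℕ}
    (he : IsBlockEigenvector (leftMul K q n) lam k e) (h : HeckeAlgebra K q n)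
    (f : (Fin n → Bool) → K) :
    wordMap e k (wordRep q lam hlam h f) = h * wordMap e k f := by
  induction h using heckeAlgebra_induction generalizing f with
  | gen i => rw [wordRep_gen, wordMap_act he]
  | scalar c =>
    rw [AlgHom.commutes, Module.algebraMap_end_apply, map_smul, Algebra.smul_def]
  | add a b ha hb => rw [map_add, LinearMap.add_apply, map_add, ha, hb, add_mul]
  | mul a b ha hb => rw [map_mul, Module.End.mul_apply, ha, hb, mul_assoc]

theorem wordMap_sortedWord (e : HeckeAlgebra K q n) (k : ℕ) :
    wordMap e k (Pi.single (sortedWord n k) 1) = e := by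
  rw [wordMap_single, wordElement, if_pos (hasContent_sortedWord k), sort_sortedWord, T_one,
    one_mul]

theorem isBlockEigenvector_single (k : ℕ) :
    IsBlockEigenvector (act q lam) lam k (Pi.single (sortedWord n k) 1) := by
  have key : ∀ (c : Bool) (i : Fin (n - 1)), sortedWord n k (lo i) = c →
      sortedWord n k (hi i) = c →
      act q lam i (Pi.single (sortedWord n k) 1) = lam c • Pi.single (sortedWord n k) 1 := by
    intro c i h₁ h₂
    rw [act_single, diagCoeff, offCoeff, swapWord_lo, swapWord_hi, h₁, h₂, if_pos rfl, if_pos rfl,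
      zero_smul, add_zero]
  constructor <;> rintro i ⟨h₁, h₂⟩ <;> apply key <;>
    simp only [sortedWord_eq_true, sortedWord_eq_false, val_lo, val_hi] <;> omega

/-- The block eigenvectors among the functions on the words with `k` letters `false`. -/
def eigenSubmodule (q : K) (n : ℕ) (lam mu : Bool → K) (k k' : ℕ) :
    Submodule K ((Fin n → Bool) → K) where
  carrier := {f | f ∈ contentSubmodule K n k ∧ IsBlockEigenvector (act q lam) mu k' f}
  add_mem' := by
    rintro f g ⟨hf, hf₁, hf₂⟩ ⟨hg, hg₁, hg₂⟩
    refine ⟨Submodule.add_mem _ hf hg, fun i hi => ?_, fun i hi => ?_⟩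
    · rw [map_add, hf₁ i hi, hg₁ i hi, smul_add]
    · rw [map_add, hf₂ i hi, hg₂ i hi, smul_add]
  zero_mem' := ⟨Submodule.zero_mem _, fun i _ => by simp, fun i _ => by simp⟩
  smul_mem' := by
    rintro c f ⟨hf, hf₁, hf₂⟩
    refine ⟨Submodule.smul_mem _ c hf, fun i hi => ?_, fun i hi => ?_⟩
    · rw [map_smul, hf₁ i hi, smul_comm]
    · rw [map_smul, hf₂ i hi, smul_comm]

/-- The isomorphism is `a ↦ a v`, with `v` the delta function of the sorted word. Its values are
block eigenvectors because `e'` absorbs the generators of its blocks on the left. -/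
theorem rank_corner_eq (hlam : IsEigenvaluePair q lam) (hq : q ≠ 0) {mu : Bool → K}
    {k k' : ℕ} {e e' : HeckeAlgebra K q n} (hidem : IsIdempotentElem e)
    (he : IsBlockEigenvector (leftMul K q n) lam k e)
    (hfix : ∀ f, IsBlockEigenvector (act q lam) lam k f → wordRep q lam hlam e f = f)
    (he' : IsBlockEigenvector (leftMul K q n) mu k' e')
    (hfix' : ∀ f, IsBlockEigenvector (act q lam) mu k' f → wordRep q lam hlam e' f = f) :
    Module.rank K (corner K q n e' e) = Module.rank K (eigenSubmodule q n lam mu k k') := by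
  let v : (Fin n → Bool) → K := Pi.single (sortedWord n k) 1
  have hv : wordRep q lam hlam e v = v := hfix v (isBlockEigenvector_single k)
  let ψ : HeckeAlgebra K q n →ₗ[K] ((Fin n → Bool) → K) :=
    (LinearMap.applyₗ v).comp (wordRep q lam hlam).toLinearMap
  have hψ : ∀ h, ψ h = wordRep q lam hlam h v := fun _ => rfl
  have hmem : ∀ a : corner K q n e' e, ψ a ∈ eigenSubmodule q n lam mu k k' := by
    rintro ⟨_, h, rfl⟩
    rw [hψ]
    refine ⟨wordRep_mem_contentSubmodule hlam _ (single_sortedWord_mem k), fun i hi => ?_,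
      fun i hi => ?_⟩
    all_goals
      simp only [LinearMap.mulLeftRight_apply]
      rw [← wordRep_gen q lam hlam, ← Module.End.mul_apply, ← map_mul, ← mul_assoc, ← mul_assoc]
    · have := he'.1 i hi
      rw [leftMul_apply] at this
      rw [this, smul_mul_assoc, smul_mul_assoc, map_smul, LinearMap.smul_apply]
    · have := he'.2 i hi
      rw [leftMul_apply] at this
      rw [this, smul_mul_assoc, smul_mul_assoc, map_smul, LinearMap.smul_apply]
  refine (LinearEquiv.ofBijective
    ((ψ.domRestrict (corner K q n e' e)).codRestrict (eigenSubmodule q n lam mu k k') hmem)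
    ⟨?_, ?_⟩).rank_eq
  · rw [injective_iff_map_eq_zero]
    rintro ⟨a, ha⟩ h₀
    have h₁ : ψ a = 0 := congrArg Subtype.val h₀
    obtain ⟨h, rfl⟩ := id ha
    -- Since `wordMap` sends `v` to `e`, it sends `a v` to `a e = a`; so `a v = 0` forces `a = 0`.
    have h₂ := wordMap_wordRep hlam he (LinearMap.mulLeftRight K (e', e) h) v
    rw [← hψ, h₁, map_zero, wordMap_sortedWord, LinearMap.mulLeftRight_apply, mul_assoc,
      hidem.eq] at h₂
    exact Subtype.ext h₂.symm
  · rintro ⟨f, hf, hf'⟩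
    obtain ⟨h, hh⟩ := exists_wordRep_eq hlam hq hf
    -- As `v` generates, `f = h v`; then `e' h e v = e' h v = e' f = f`.
    refine ⟨⟨e' * h * e, h, rfl⟩, Subtype.ext ?_⟩
    change wordRep q lam hlam (e' * h * e) v = f
    rw [map_mul, map_mul, Module.End.mul_apply, Module.End.mul_apply, hv, hh, hfix' f hf']

/-! ### The idempotents -/

/-- The common form of the idempotents `ε_r`, attached to the blocks `[1, k]` and `[k + 1, n]`. -/
noncomputable def blockIdempotent (q : K) (n : ℕ) (mu : Bool → K) (k : ℕ) :
    HeckeAlgebra K q n :=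
  (qFactorial (mu false * mu false * q⁻¹) k * qFactorial (mu true * mu true * q⁻¹) (n - k))⁻¹ •
    (blockSum K q n (mu false) 1 k * blockSum K q n (mu true) (k + 1) n)

theorem IsEigenvaluePair.quad {mu : Bool → K} (h : IsEigenvaluePair q mu) (c : Bool) :
    mu c * mu c = (q - 1) * mu c + q := by
  rcases h with ⟨h₁, h₂⟩ | ⟨h₁, h₂⟩ <;> cases c <;> simp only [h₁, h₂] <;> ring

theorem IsEigenvaluePair.sq_mul_inv {mu : Bool → K} (h : IsEigenvaluePair q mu) (hq : q ≠ 0)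
    (c : Bool) : mu c * mu c * q⁻¹ = q ∨ mu c * mu c * q⁻¹ = q⁻¹ := by
  rcases h with ⟨h₁, h₂⟩ | ⟨h₁, h₂⟩ <;> cases c <;> simp [h₁, h₂, hq]

theorem isBlockEigenvector_blockIdempotent {mu : Bool → K} (hmu : IsEigenvaluePair q mu)
    (hq : q ≠ 0) (k : ℕ) :
    IsBlockEigenvector (leftMul K q n) mu k (blockIdempotent q n mu k) := by
  constructor <;> intro i hi <;> rw [leftMul_apply, blockIdempotent, mul_smul_comm]
  · rw [← mul_assoc, gen_mul_blockSum hq (hmu.quad _) hi, smul_mul_assoc, smul_comm]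
  · rw [(commute_blockSum (Nat.lt_succ_self k)).eq, ← mul_assoc,
      gen_mul_blockSum hq (hmu.quad _) hi, smul_mul_assoc, smul_comm]

/-- A vanishing factor `1 + u + ⋯ + u ^ (j - 1)` would give `u ^ j = 1` with `0 < j < l`. -/
theorem qFactorial_ne_zero {u : K} {l m : ℕ} (hu : IsPrimitiveRoot u l) (hm : m < l) :
    qFactorial u m ≠ 0 := by
  refine Finset.prod_ne_zero_iff.2 fun j hj h₀ => ?_
  rw [Finset.mem_Icc] at hj
  have := geom_sum_mul u j
  rw [h₀, zero_mul, eq_comm, sub_eq_zero] at this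
  exact hu.pow_ne_one_of_pos_of_lt (by omega) (by omega) this

theorem rep_blockIdempotent {mu : Bool → K} (hmu : IsEigenvaluePair q mu)
    (hq : IsPrimitiveRoot q n) {k : ℕ} (hk : 1 ≤ k) (hkn : k < n) {M : Type*} [AddCommGroup M]
    [Module K M] (ρ : HeckeAlgebra K q n →ₐ[K] Module.End K M) {f : M}
    (hf : IsBlockEigenvector (fun i => ρ (gen K q n i)) mu k f) :
    ρ (blockIdempotent q n mu k) f = f := by
  have hq₀ : q ≠ 0 := hq.ne_zero (by omega)
  have h₁ := rep_blockSum_apply ρ (c := 0) (m := k) (by omega) (f := f) (μ := mu false)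
    (by simpa using hf.1)
  have hadd : k + (n - k) = n := by omega
  have h₂ := rep_blockSum_apply ρ (c := k) (m := n - k) (by omega) (f := f) (μ := mu true)
    (by rw [hadd]; exact hf.2)
  rw [hadd] at h₂
  rw [zero_add, zero_add] at h₁
  have hne : ∀ (c : Bool) (m : ℕ), m < n → qFactorial (mu c * mu c * q⁻¹) m ≠ 0 := by
    intro c m hm
    rcases hmu.sq_mul_inv hq₀ c with h | h <;> rw [h]
    · exact qFactorial_ne_zero hq hm
    · exact qFactorial_ne_zero hq.inv hm
  rw [blockIdempotent, map_smul, map_mul, LinearMap.smul_apply, Module.End.mul_apply, h₂, map_smul,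
    h₁, smul_smul, smul_smul, mul_assoc, mul_comm (qFactorial _ (n - k)), inv_mul_cancel₀, one_smul]
  exact mul_ne_zero (hne _ _ hkn) (hne _ _ (by omega))

/-- In the left regular representation the element is itself a block eigenvector, hence is fixed by
its own action. -/
theorem isIdempotentElem_blockIdempotent {mu : Bool → K} (hmu : IsEigenvaluePair q mu)
    (hq : IsPrimitiveRoot q n) {k : ℕ} (hk : 1 ≤ k) (hkn : k < n) :
    IsIdempotentElem (blockIdempotent q n mu k) :=
  rep_blockIdempotent hmu hq hk hkn (Algebra.lmul K (HeckeAlgebra K q n))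
    (isBlockEigenvector_blockIdempotent hmu (hq.ne_zero (by omega)) k)

theorem rank_corner_blockIdempotent (hlam : IsEigenvaluePair q lam) {mu : Bool → K}
    (hmu : IsEigenvaluePair q mu) (hq : IsPrimitiveRoot q n) {k k' : ℕ} (hk : 1 ≤ k) (hkn : k < n)
    (hk' : 1 ≤ k') (hkn' : k' < n) :
    Module.rank K (corner K q n (blockIdempotent q n mu k') (blockIdempotent q n lam k))
      = Module.rank K (eigenSubmodule q n lam mu k k') := by
  have hq₀ : q ≠ 0 := hq.ne_zero (by omega)
  have hgen : (fun i => wordRep q lam hlam (gen K q n i)) = act q lam :=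
    funext fun i => wordRep_gen q lam hlam i
  refine rank_corner_eq hlam hq₀ (isIdempotentElem_blockIdempotent hlam hq hk hkn)
    (isBlockEigenvector_blockIdempotent hlam hq₀ k) (fun f hf => ?_)
    (isBlockEigenvector_blockIdempotent hmu hq₀ k') (fun f hf => ?_)
  · exact rep_blockIdempotent hlam hq hk hkn _ (by rwa [hgen])
  · exact rep_blockIdempotent hmu hq hk' hkn' _ (by rwa [hgen])

end Corner

section Eigenvectors

variable {K : Type*} [Field K] {q : K} {n : ℕ} {lam : Bool → K}

/-! ### Block eigenvectors in the module of words -/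

theorem isBlockEigenvector_iff {mu : Bool → K} {k : ℕ} {M : Type*} [AddCommGroup M] [Module K M]
    {t : Fin (n - 1) → Module.End K M} {f : M} :
    IsBlockEigenvector t mu k f ↔ ∀ i, sortedWord n k (lo i) = sortedWord n k (hi i) →
      t i f = mu (sortedWord n k (lo i)) • f := by
  refine ⟨fun h i => h.apply_of_eq, fun h => ⟨?_, ?_⟩⟩ <;> rintro i ⟨h₁, h₂⟩
  · have e₁ : sortedWord n k (lo i) = false := by rw [sortedWord_eq_false, val_lo]; omega
    have e₂ : sortedWord n k (hi i) = false := by rw [sortedWord_eq_false, val_hi]; omega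
    have := h i (e₁.trans e₂.symm)
    rwa [e₁] at this
  · have e₁ : sortedWord n k (lo i) = true := by rw [sortedWord_eq_true, val_lo]; omega
    have e₂ : sortedWord n k (hi i) = true := by rw [sortedWord_eq_true, val_hi]; omega
    have := h i (e₁.trans e₂.symm)
    rwa [e₁] at this

theorem IsEigenvaluePair.ne_zero (hlam : IsEigenvaluePair q lam) (hq : q ≠ 0) (c : Bool) :
    lam c ≠ 0 := by
  rcases hlam with ⟨h₁, h₂⟩ | ⟨h₁, h₂⟩ <;> cases c <;> simp [h₁, h₂, hq]

theorem IsEigenvaluePair.ne_of_ne (hlam : IsEigenvaluePair q lam) (hq : q ≠ -1) {c d : Bool}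
    (h : c ≠ d) : lam c ≠ lam d := by
  rcases hlam with ⟨h₁, h₂⟩ | ⟨h₁, h₂⟩ <;> cases c <;> cases d <;>
    simp_all [eq_comm]

/-- At equal letters `T_i` is diagonal, and `q ≠ -1` separates the two eigenvalues. At different
letters the equations for `w` and for the swapped word are equivalent, so one of them suffices. -/
theorem act_eq_smul_iff (hlam : IsEigenvaluePair q lam) (hq : q ≠ 0) (hq' : q ≠ -1)
    {i : Fin (n - 1)} {m : Bool} {f : (Fin n → Bool) → K} :
    act q lam i f = lam m • f ↔ ∀ w, (w (lo i) = w (hi i) → w (lo i) ≠ m → f w = 0) ∧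
      (w (lo i) = false → w (hi i) = true → q * f (swapWord i w) = lam m * f w) := by
  have hquad := hlam.quad m
  constructor
  · intro h w
    have hw := congrFun h w
    rw [act_apply, Pi.smul_apply, smul_eq_mul, diagCoeff, offCoeff] at hw
    constructor
    · intro h₁ h₂
      rw [if_pos h₁, if_pos h₁, zero_mul, add_zero, ← sub_eq_zero, ← sub_mul] at hw
      exact (mul_eq_zero.1 hw).resolve_left (sub_ne_zero.2 (hlam.ne_of_ne hq' h₂))
    · intro h₁ h₂
      simpa [h₁, h₂] using hw
  · intro h
    funext w
    rw [act_apply, Pi.smul_apply, smul_eq_mul, diagCoeff, offCoeff]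
    by_cases h₁ : w (lo i) = w (hi i)
    · rw [if_pos h₁, if_pos h₁, zero_mul, add_zero]
      by_cases h₂ : w (lo i) = m
      · rw [h₂]
      · rw [(h w).1 h₁ h₂, mul_zero, mul_zero]
    · rw [if_neg h₁, if_neg h₁]
      cases h₂ : w (lo i) <;> cases h₃ : w (hi i)
      · exact absurd (h₂.trans h₃.symm) h₁
      · simpa using (h w).2 h₂ h₃
      -- The equation at `true, false` is, after multiplication by `lam m`, the one at `false, true`
      -- combined with the quadratic equation for `lam m`.
      · have h₄ := (h (swapWord i w)).2 (by rwa [swapWord_lo]) (by rwa [swapWord_hi])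
        rw [swapWord_swapWord] at h₄
        simp only [if_true, one_mul]
        refine mul_left_cancel₀ (hlam.ne_zero hq m) ?_
        linear_combination -h₄ - f w * hquad
      · exact absurd (h₂.trans h₃.symm) h₁

/-- The letter of the majority at every place, if the first block `[1, k]` has majority `d`, and
the second one its opposite. -/
def majority (n : ℕ) (d : Bool) (k : ℕ) (p : Fin n) : Bool := xor d (sortedWord n k p)

theorem majority_congr {d : Bool} {k : ℕ} {p p' : Fin n}
    (h : sortedWord n k p = sortedWord n k p') : majority n d k p = majority n d k p' := by
  rw [majority, majority, h]

/-- A local form of the eigenvector equations. -/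
def IsBlockFunction (q : K) (lam : Bool → K) (d : Bool) (k : ℕ) (f : (Fin n → Bool) → K) : Prop :=
  ∀ i, sortedWord n k (lo i) = sortedWord n k (hi i) → ∀ w,
    (w (lo i) = w (hi i) → w (lo i) ≠ majority n d k (lo i) → f w = 0) ∧
    (w (lo i) = false → w (hi i) = true →
      q * f (swapWord i w) = lam (majority n d k (lo i)) * f w)

theorem isBlockEigenvector_act_iff (hlam : IsEigenvaluePair q lam) (hq : q ≠ 0) (hq' : q ≠ -1)
    {d : Bool} {k : ℕ} {f : (Fin n → Bool) → K} :
    IsBlockEigenvector (act q lam) (fun c => lam (xor d c)) k f ↔ IsBlockFunction q lam d k f := by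
  rw [isBlockEigenvector_iff]
  exact forall_congr' fun i => imp_congr_right fun _ => act_eq_smul_iff hlam hq hq'

namespace IsBlockFunction

variable {d : Bool} {k : ℕ} {f : (Fin n → Bool) → K}

/-- Within a block a swap of different letters scales the value by a unit, so the support of `f` is
stable under permutations inside the blocks. -/
theorem swapWord_ne_zero (hf : IsBlockFunction q lam d k f) (hlam : IsEigenvaluePair q lam)
    (hq : q ≠ 0) {i : Fin (n - 1)} (hi' : sortedWord n k (lo i) = sortedWord n k (hi i))
    {w : Fin n → Bool} (hw : f w ≠ 0) : f (swapWord i w) ≠ 0 := by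
  have hm := hlam.ne_zero hq (majority n d k (lo i))
  by_cases h : w (lo i) = w (hi i)
  · rwa [swapWord_eq_self i h]
  · intro h₀
    cases h₁ : w (lo i) <;> cases h₂ : w (hi i)
    · exact h (h₁.trans h₂.symm)
    · have := (hf i hi' w).2 h₁ h₂
      rw [h₀, mul_zero] at this
      exact mul_ne_zero hm hw this.symm
    · have := (hf i hi' (swapWord i w)).2 (by rwa [swapWord_lo]) (by rwa [swapWord_hi])
      rw [h₀, mul_zero, swapWord_swapWord] at this
      exact mul_ne_zero hq hw this
    · exact h (h₁.trans h₂.symm)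

theorem sortedWord_eq_of_between {a b c : Fin n} (hab : a ≤ b) (hbc : b ≤ c)
    (h : sortedWord n k a = sortedWord n k c) : sortedWord n k b = sortedWord n k a := by
  refine le_antisymm ?_ (sortedWord_monotone k hab)
  rw [h]
  exact sortedWord_monotone k hbc

theorem comp_swap_ne_zero_of_lt (hf : IsBlockFunction q lam d k f)
    (hlam : IsEigenvaluePair q lam) (hq : q ≠ 0) {p : Fin n} (m : ℕ) (hm : (p : ℕ) + 1 ≤ m)
    (hmn : m < n) (hb : sortedWord n k p = sortedWord n k ⟨m, hmn⟩) {w : Fin n → Bool}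
    (hw : f w ≠ 0) : f (w ∘ Equiv.swap p ⟨m, hmn⟩) ≠ 0 := by
  induction m, hm using Nat.le_induction generalizing w with
  | base =>
    exact hf.swapWord_ne_zero hlam hq (i := ⟨p, by omega⟩) hb hw
  | succ m hm ih =>
    let p' : Fin n := ⟨m, by omega⟩
    let i : Fin (n - 1) := ⟨m, by omega⟩
    have hlo : (lo i : Fin n) = p' := rfl
    have hhi : (hi i : Fin n) = ⟨m + 1, hmn⟩ := rfl
    have hb' : sortedWord n k p' = sortedWord n k p :=
      sortedWord_eq_of_between (by rw [Fin.le_def]; simp only [p']; omega)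
        (by rw [Fin.le_def]; simp only [p']; omega) hb
    have hbi : sortedWord n k (lo i) = sortedWord n k (hi i) := by rw [hlo, hhi, hb', hb]
    have h₁ := hf.swapWord_ne_zero hlam hq hbi hw
    have h₂ := hf.swapWord_ne_zero hlam hq hbi (ih (by omega) hb'.symm h₁)
    have hp : simpleTransposition n i p = p :=
      simpleTransposition_of_ne i (by rw [Ne, Fin.ext_iff, val_lo]; simp only [i]; omega)
        (by rw [Ne, Fin.ext_iff, val_hi]; simp only [i]; omega)
    -- The transposition `(p m+1)` is `(p m)` conjugated by `s_i`.
    have hsw := Equiv.swap_apply_apply (simpleTransposition n i) p p'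
    rw [hp, ← hlo, simpleTransposition_lo, simpleTransposition_inv, hhi] at hsw
    rw [hsw]
    exact h₂

theorem comp_swap_ne_zero (hf : IsBlockFunction q lam d k f) (hlam : IsEigenvaluePair q lam)
    (hq : q ≠ 0) {p p' : Fin n} (hb : sortedWord n k p = sortedWord n k p') {w : Fin n → Bool}
    (hw : f w ≠ 0) : f (w ∘ Equiv.swap p p') ≠ 0 := by
  rcases lt_trichotomy p p' with h | rfl | h
  · exact hf.comp_swap_ne_zero_of_lt hlam hq p' h p'.isLt hb hw
  · simpa using hw
  · rw [Equiv.swap_comm]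
    exact hf.comp_swap_ne_zero_of_lt hlam hq p h p.isLt hb.symm hw

/-- Permuting inside the block brings the second deviation next to the first, where equal adjacent
minority letters force the value 0. -/
theorem eq_zero_of_two_deviations (hf : IsBlockFunction q lam d k f)
    (hlam : IsEigenvaluePair q lam) (hq : q ≠ 0) {p p' : Fin n} (hlt : p < p')
    (hb : sortedWord n k p = sortedWord n k p') {w : Fin n → Bool}
    (hp : w p ≠ majority n d k p) (hp' : w p' ≠ majority n d k p') : f w = 0 := by
  by_contra hw
  rw [Fin.lt_def] at hlt
  let i : Fin (n - 1) := ⟨p, by omega⟩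
  have hlo : (lo i : Fin n) = p := rfl
  have hhi : ((hi i : Fin n) : ℕ) = p + 1 := rfl
  have hbi : sortedWord n k (hi i) = sortedWord n k p :=
    sortedWord_eq_of_between (by rw [Fin.le_def]; omega) (by rw [Fin.le_def]; omega) hb
  have hmaj := majority_congr (d := d) hb
  have hpp : w p = w p' := by
    rw [hmaj] at hp
    rw [Bool.eq_not.2 hp, Bool.eq_not.2 hp']
  refine hf.comp_swap_ne_zero hlam hq (p := hi i) (p' := p') (hbi.trans hb) hw ?_
  have h₁ : (w ∘ Equiv.swap (hi i) p') (lo i) = w p := by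
    rw [Function.comp_apply, hlo, Equiv.swap_apply_of_ne_of_ne]
    · rw [Ne, Fin.ext_iff]; omega
    · rw [Ne, Fin.ext_iff]; omega
  have h₂ : (w ∘ Equiv.swap (hi i) p') (hi i) = w p' := by
    rw [Function.comp_apply, Equiv.swap_apply_left]
  refine (hf i (by rw [hlo, hbi]) _).1 (by rw [h₁, h₂, hpp]) ?_
  rw [h₁, hlo]
  exact hp

/-- Exchange a deviating place, if there is one, with `t`. Since the value stays nonzero, no second
deviation can remain in that block. -/
theorem exists_concentrated (hf : IsBlockFunction q lam d k f) (hlam : IsEigenvaluePair q lam)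
    (hq : q ≠ 0) (t : Fin n) {w : Fin n → Bool} (hw : f w ≠ 0) :
    ∃ w', f w' ≠ 0 ∧
      (∀ p, sortedWord n k p = sortedWord n k t → p ≠ t → w' p = majority n d k p) ∧
      (∀ p, sortedWord n k p ≠ sortedWord n k t → w' p = w p) := by
  by_cases h : ∃ p, sortedWord n k p = sortedWord n k t ∧ w p ≠ majority n d k p
  · obtain ⟨p, hb, hp⟩ := h
    have hw' := hf.comp_swap_ne_zero hlam hq hb hw
    refine ⟨_, hw', fun p' hb' hne => ?_, fun p' hb' => ?_⟩
    · by_contra hdev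
      have ht : (w ∘ Equiv.swap p t) t ≠ majority n d k t := by
        rw [Function.comp_apply, Equiv.swap_apply_right, ← majority_congr hb]
        exact hp
      rcases lt_or_gt_of_ne hne with hlt | hlt
      · exact hw' (hf.eq_zero_of_two_deviations hlam hq hlt hb' hdev ht)
      · exact hw' (hf.eq_zero_of_two_deviations hlam hq hlt hb'.symm ht hdev)
    · rw [Function.comp_apply, Equiv.swap_apply_of_ne_of_ne]
      · rintro rfl
        exact hb' hb
      · rintro rfl
        exact hb' rfl
  · push Not at h
    exact ⟨w, hw, fun p hb _ => h p hb, fun _ _ => rfl⟩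

end IsBlockFunction

/-- The word which agrees with the majority except possibly at the first and the last place. -/
def cornerWord (d : Bool) (k : ℕ) (s t : Fin n) (ab : Bool × Bool) : Fin n → Bool :=
  Function.update (Function.update (majority n d k) s (xor d ab.1)) t (xor (!d) ab.2)

section CornerWord

variable {d : Bool} {k : ℕ} {s t : Fin n}

theorem ne_of_sortedWord (hs : sortedWord n k s = false) (ht : sortedWord n k t = true) :
    s ≠ t := by
  rintro rfl
  rw [hs] at ht
  exact absurd ht (by decide)

theorem cornerWord_left (hs : sortedWord n k s = false) (ht : sortedWord n k t = true)
    (ab : Bool × Bool) : cornerWord d k s t ab s = xor d ab.1 := by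
  rw [cornerWord, Function.update_of_ne (ne_of_sortedWord hs ht), Function.update_self]

theorem cornerWord_right (ab : Bool × Bool) : cornerWord d k s t ab t = xor (!d) ab.2 := by
  rw [cornerWord, Function.update_self]

theorem cornerWord_of_ne (ab : Bool × Bool) {p : Fin n} (h₁ : p ≠ s) (h₂ : p ≠ t) :
    cornerWord d k s t ab p = majority n d k p := by
  rw [cornerWord, Function.update_of_ne h₂, Function.update_of_ne h₁]

/-- A word of the support can be moved inside the support until it deviates only at `s` and `t`,
that is, until it is one of the four corner words. -/
theorem IsBlockFunction.eq_zero (hs : sortedWord n k s = false) (ht : sortedWord n k t = true)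
    {f : (Fin n → Bool) → K} (hf : IsBlockFunction q lam d k f)
    (hlam : IsEigenvaluePair q lam) (hq : q ≠ 0)
    (h₀ : ∀ ab, f (cornerWord d k s t ab) = 0) : f = 0 := by
  funext w
  by_contra hw
  obtain ⟨w₁, hw₁, hm₁, -⟩ := hf.exists_concentrated hlam hq s hw
  obtain ⟨w₂, hw₂, hm₂, heq⟩ := hf.exists_concentrated hlam hq t hw₁
  refine hw₂ ?_
  have hw₂' : w₂ = cornerWord d k s t (xor d (w₂ s), xor (!d) (w₂ t)) := by
    funext p
    by_cases h₁ : p = s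
    · subst h₁
      rw [cornerWord_left hs ht]
      cases d <;> simp
    · by_cases h₂ : p = t
      · subst h₂
        rw [cornerWord_right]
        cases d <;> simp
      · rw [cornerWord_of_ne _ h₁ h₂]
        cases hp : sortedWord n k p
        · rw [heq p (by rw [hp, ht]; decide)]
          exact hm₁ p (by rw [hp, hs]) h₁
        · exact hm₂ p (by rw [hp, ht]) h₂
  rw [hw₂']
  exact h₀ _

end CornerWord

end Eigenvectors

section Dimension

variable {K : Type*} [Field K] {q : K} {n : ℕ} {lam : Bool → K}

/-! ### A basis of the block eigenvectors -/

/-- The number of places in the block `c` where `w` deviates from the majority. -/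
def deviationCount (d : Bool) (k : ℕ) (c : Bool) (w : Fin n → Bool) : ℕ :=
  (Finset.univ.filter fun p => sortedWord n k p = c ∧ w p ≠ majority n d k p).card

theorem sortedWord_simpleTransposition {k : ℕ} {i : Fin (n - 1)}
    (hi' : sortedWord n k (lo i) = sortedWord n k (hi i)) (p : Fin n) :
    sortedWord n k (simpleTransposition n i p) = sortedWord n k p :=
  congrFun (swapWord_eq_self i hi') p

theorem deviationCount_swapWord (d : Bool) {k : ℕ} (c : Bool) {i : Fin (n - 1)}
    (hi' : sortedWord n k (lo i) = sortedWord n k (hi i)) (w : Fin n → Bool) :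
    deviationCount d k c (swapWord i w) = deviationCount d k c w := by
  refine Finset.card_equiv (simpleTransposition n i) fun p => ?_
  rw [Finset.mem_filter, Finset.mem_filter, sortedWord_simpleTransposition hi',
    majority_congr (sortedWord_simpleTransposition hi' p)]
  simp [swapWord]

/-- The coefficient of a deviation from the majority at the place `p`. -/
def deviationWeight (q : K) (lam : Bool → K) (d : Bool) (k : ℕ) (p : Fin n) : K :=
  (if majority n d k p then lam true / q else q / lam false) ^ (p : ℕ)

/-- The product of the coefficients of all deviations of `w` from the majority. -/
def wordWeight (q : K) (lam : Bool → K) (d : Bool) (k : ℕ) (w : Fin n → Bool) : K :=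
  ∏ p, if w p = majority n d k p then 1 else deviationWeight q lam d k p

theorem wordWeight_ne_zero (hlam : IsEigenvaluePair q lam) (hq : q ≠ 0) (d : Bool) (k : ℕ)
    (w : Fin n → Bool) : wordWeight q lam d k w ≠ 0 := by
  refine Finset.prod_ne_zero_iff.2 fun p _ => ?_
  unfold deviationWeight
  split_ifs
  · exact one_ne_zero
  · exact pow_ne_zero _ (div_ne_zero (hlam.ne_zero hq _) hq)
  · exact pow_ne_zero _ (div_ne_zero hq (hlam.ne_zero hq _))

/-- Exactly one of the two different letters deviates. The swap moves a minority `false` one place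
to the right, or a minority `true` one place to the left, and the powers in `deviationWeight` are
chosen so that either move multiplies by the eigenvalue divided by `q`. -/
theorem wordWeight_swapWord (hlam : IsEigenvaluePair q lam) (hq : q ≠ 0) (d : Bool) {k : ℕ}
    {i : Fin (n - 1)} (hi' : sortedWord n k (lo i) = sortedWord n k (hi i)) {w : Fin n → Bool}
    (h₁ : w (lo i) = false) (h₂ : w (hi i) = true) :
    q * wordWeight q lam d k (swapWord i w)
      = lam (majority n d k (lo i)) * wordWeight q lam d k w := by
  have hmem : (hi i : Fin n) ∈ Finset.univ.erase (lo i) :=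
    Finset.mem_erase.2 ⟨(lo_ne_hi i).symm, Finset.mem_univ _⟩
  have hmaj := majority_congr (d := d) hi'
  have hf := hlam.ne_zero hq false
  rw [wordWeight, wordWeight, ← Finset.mul_prod_erase _ _ (Finset.mem_univ (lo i)),
    ← Finset.mul_prod_erase _ _ hmem, ← Finset.mul_prod_erase Finset.univ
      (fun p => if w p = majority n d k p then 1 else deviationWeight q lam d k p)
      (Finset.mem_univ (lo i)), ← Finset.mul_prod_erase (Finset.univ.erase (lo i))
      (fun p => if w p = majority n d k p then 1 else deviationWeight q lam d k p) hmem]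
  have hrest : ∀ p ∈ (Finset.univ.erase (lo i)).erase (hi i),
      (if swapWord i w p = majority n d k p then (1 : K) else deviationWeight q lam d k p)
        = if w p = majority n d k p then 1 else deviationWeight q lam d k p := by
    intro p hp
    rw [Finset.mem_erase, Finset.mem_erase] at hp
    rw [swapWord_of_ne i w hp.2.1 hp.1]
  rw [Finset.prod_congr rfl hrest, swapWord_lo, swapWord_hi, h₁, h₂]
  simp only [deviationWeight, ← hmaj, val_lo, val_hi]
  cases majority n d k (lo i)
  · simp only [Bool.false_eq_true, reduceCtorEq, if_true, if_false, pow_succ]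
    field_simp
  · simp only [Bool.false_eq_true, if_true, if_false, pow_succ]
    field_simp

open Classical in
/-- The block eigenvector supported on the words of content `N` with prescribed numbers of
deviations in the two blocks. -/
noncomputable def deviationFunction (q : K) (lam : Bool → K) (d : Bool) (N k : ℕ)
    (ab : Bool × Bool) (w : Fin n → Bool) : K :=
  if HasContent N w ∧ deviationCount d k false w = ab.1.toNat ∧
    deviationCount d k true w = ab.2.toNat then wordWeight q lam d k w else 0

/-- Equal adjacent minority letters would give two deviations in one block, which the prescribed
counts exclude; swaps inside a block preserve the counts and the content. -/
theorem isBlockFunction_deviationFunction (hlam : IsEigenvaluePair q lam) (hq : q ≠ 0) (d : Bool)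
    (N k : ℕ) (ab : Bool × Bool) :
    IsBlockFunction q lam d k (deviationFunction (n := n) q lam d N k ab) := by
  intro i hi' w
  constructor
  · intro h₁ h₂
    refine if_neg ?_
    rintro ⟨-, ha, hb⟩
    have hcount : 1 < deviationCount d k (sortedWord n k (lo i)) w := by
      refine Finset.one_lt_card.2 ⟨lo i, ?_, hi i, ?_, lo_ne_hi i⟩
      · exact Finset.mem_filter.2 ⟨Finset.mem_univ _, rfl, h₂⟩
      · refine Finset.mem_filter.2 ⟨Finset.mem_univ _, hi'.symm, ?_⟩
        rw [← h₁, ← majority_congr hi']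
        exact h₂
    have := Bool.toNat_le ab.1
    have := Bool.toNat_le ab.2
    cases hc : sortedWord n k (lo i) <;> rw [hc] at hcount <;> omega
  · intro h₁ h₂
    rw [deviationFunction, deviationFunction, hasContent_swapWord, deviationCount_swapWord d _ hi',
      deviationCount_swapWord d _ hi']
    split_ifs
    · exact wordWeight_swapWord hlam hq d hi' h₁ h₂
    · rw [mul_zero, mul_zero]

theorem deviationFunction_mem_contentSubmodule (d : Bool) (N k : ℕ) (ab : Bool × Bool) :
    deviationFunction q lam d N k ab ∈ contentSubmodule K n N :=
  fun _ hw => if_neg fun h => hw h.1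

section CornerWord

variable {d : Bool} {k : ℕ} {s t : Fin n}

theorem cornerWord_ne_majority_iff (hs : sortedWord n k s = false)
    (ht : sortedWord n k t = true) (ab : Bool × Bool) (p : Fin n) :
    cornerWord d k s t ab p ≠ majority n d k p ↔ p = s ∧ ab.1 = true ∨ p = t ∧ ab.2 = true := by
  have hst := ne_of_sortedWord hs ht
  by_cases h₁ : p = s
  · subst h₁
    rw [cornerWord_left hs ht, majority, hs]
    cases d <;> cases ab.1 <;> simp [hst]
  · by_cases h₂ : p = t
    · subst h₂
      rw [cornerWord_right, majority, ht]
      cases d <;> cases ab.2 <;> simp [h₁]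
    · rw [cornerWord_of_ne _ h₁ h₂]
      simp [h₁, h₂]

theorem deviationCount_false_cornerWord (hs : sortedWord n k s = false)
    (ht : sortedWord n k t = true) (ab : Bool × Bool) :
    deviationCount d k false (cornerWord d k s t ab) = ab.1.toNat := by
  rw [deviationCount]
  simp only [cornerWord_ne_majority_iff hs ht]
  cases h : ab.1
  · refine Finset.card_eq_zero.2 (Finset.filter_eq_empty_iff.2 ?_)
    rintro p - ⟨h₁, ⟨-, h₂⟩ | ⟨rfl, -⟩⟩
    · exact absurd h₂ (by decide)
    · rw [ht] at h₁
      exact absurd h₁ (by decide)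
  · refine Finset.card_eq_one.2 ⟨s, ?_⟩
    ext p
    rw [Finset.mem_filter, Finset.mem_singleton]
    constructor
    · rintro ⟨-, h₁, ⟨h₂, -⟩ | ⟨rfl, -⟩⟩
      · exact h₂
      · rw [ht] at h₁
        exact absurd h₁ (by decide)
    · rintro rfl
      exact ⟨Finset.mem_univ _, hs, Or.inl ⟨rfl, rfl⟩⟩

theorem deviationCount_true_cornerWord (hs : sortedWord n k s = false)
    (ht : sortedWord n k t = true) (ab : Bool × Bool) :
    deviationCount d k true (cornerWord d k s t ab) = ab.2.toNat := by
  rw [deviationCount]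
  simp only [cornerWord_ne_majority_iff hs ht]
  cases h : ab.2
  · refine Finset.card_eq_zero.2 (Finset.filter_eq_empty_iff.2 ?_)
    rintro p - ⟨h₁, ⟨rfl, -⟩ | ⟨-, h₂⟩⟩
    · rw [hs] at h₁
      exact absurd h₁ (by decide)
    · exact absurd h₂ (by decide)
  · refine Finset.card_eq_one.2 ⟨t, ?_⟩
    ext p
    rw [Finset.mem_filter, Finset.mem_singleton]
    constructor
    · rintro ⟨-, h₁, ⟨rfl, -⟩ | ⟨h₂, -⟩⟩
      · rw [hs] at h₁
        exact absurd h₁ (by decide)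
      · exact h₂
    · rintro rfl
      exact ⟨Finset.mem_univ _, ht, Or.inr ⟨rfl, rfl⟩⟩

theorem deviationFunction_cornerWord (hs : sortedWord n k s = false)
    (ht : sortedWord n k t = true) {N : ℕ} (ab ab' : Bool × Bool)
    (h : HasContent N (cornerWord d k s t ab')) :
    deviationFunction q lam d N k ab (cornerWord d k s t ab')
      = if ab = ab' then wordWeight q lam d k (cornerWord d k s t ab') else 0 := by
  rw [deviationFunction, deviationCount_false_cornerWord hs ht,
    deviationCount_true_cornerWord hs ht]
  congr 1
  rw [eq_iff_iff, eq_comm (a := ab), Prod.ext_iff]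
  have hinj : ∀ a b : Bool, a.toNat = b.toNat → a = b := by decide
  exact ⟨fun h' => ⟨hinj _ _ h'.2.1, hinj _ _ h'.2.2⟩,
    fun h' => ⟨h, by rw [h'.1], by rw [h'.2]⟩⟩

/-- Evaluation at the corner words of content `N` is an isomorphism: a block function vanishing at
all corner words is zero, and the deviation functions are, up to units, dual to these words. -/
theorem rank_eigenSubmodule_eq_card (hs : sortedWord n k s = false)
    (ht : sortedWord n k t = true) (hlam : IsEigenvaluePair q lam) (hq : q ≠ 0) (hq' : q ≠ -1)
    (N : ℕ) :
    Module.rank K (eigenSubmodule q n lam (fun c => lam (xor d c)) N k)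
      = Nat.card {ab : Bool × Bool // HasContent N (cornerWord d k s t ab)} := by
  classical
  let I := {ab : Bool × Bool // HasContent N (cornerWord d k s t ab)}
  let ev : ((Fin n → Bool) → K) →ₗ[K] (I → K) :=
    LinearMap.funLeft K K fun ab : I => cornerWord d k s t ab.1
  have hmem : ∀ ab, deviationFunction q lam d N k ab
      ∈ eigenSubmodule q n lam (fun c => lam (xor d c)) N k := fun ab =>
    ⟨deviationFunction_mem_contentSubmodule d N k _, (isBlockEigenvector_act_iff hlam hq hq').2
      (isBlockFunction_deviationFunction hlam hq d N k _)⟩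
  have hdev : ∀ ab ab' : I, ev.domRestrict (eigenSubmodule q n lam (fun c => lam (xor d c)) N k)
      ⟨deviationFunction q lam d N k ab.1, hmem ab.1⟩ ab'
      = if ab.1 = ab'.1 then wordWeight q lam d k (cornerWord d k s t ab'.1) else 0 :=
    fun ab ab' => deviationFunction_cornerWord hs ht _ _ ab'.2
  have hbij : Function.Bijective
      (ev.domRestrict (eigenSubmodule q n lam (fun c => lam (xor d c)) N k)) := by
    constructor
    · rw [injective_iff_map_eq_zero]
      rintro ⟨f, hf, hf'⟩ h₀
      refine Subtype.ext (IsBlockFunction.eq_zero hs ht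
        ((isBlockEigenvector_act_iff hlam hq hq').1 hf') hlam hq fun ab => ?_)
      by_cases h : HasContent N (cornerWord d k s t ab)
      · exact congrFun h₀ ⟨ab, h⟩
      · exact hf _ h
    · intro g
      refine ⟨∑ ab : I, (g ab * (wordWeight q lam d k (cornerWord d k s t ab.1))⁻¹) •
        ⟨deviationFunction q lam d N k ab.1, hmem ab.1⟩, ?_⟩
      funext ab
      rw [map_sum, Finset.sum_apply, Finset.sum_eq_single ab]
      · rw [map_smul, Pi.smul_apply, hdev, if_pos rfl, smul_eq_mul, mul_assoc,
          inv_mul_cancel₀ (wordWeight_ne_zero hlam hq d k _), mul_one]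
      · intro ab' _ hne
        rw [map_smul, Pi.smul_apply, hdev, if_neg fun h => hne (Subtype.ext h), smul_zero]
      · exact fun h => absurd (Finset.mem_univ _) h
  rw [(LinearEquiv.ofBijective _ hbij).rank_eq, rank_fun', Nat.card_eq_fintype_card]

/-! ### Counting letters -/

theorem card_filter_sortedWord {k : ℕ} (hk : k ≤ n) :
    (Finset.univ.filter fun p : Fin n => sortedWord n k p = false).card = k := by
  simp only [sortedWord_eq_false]
  rw [Fin.card_filter_val_lt, min_eq_right hk]

theorem hasContent_iff {N : ℕ} (hN : N ≤ n) (w : Fin n → Bool) :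
    HasContent N w ↔ (Finset.univ.filter fun p => w p = false).card = N := by
  have hcard : (Finset.univ.filter fun p => w p = false).card
      = (Finset.univ.filter fun p => (w ∘ Tuple.sort w) p = false).card :=
    (Finset.card_equiv (Tuple.sort w) fun p => by simp).symm
  rw [HasContent, hcard]
  constructor
  · intro h
    rw [h, card_filter_sortedWord hN]
  · intro h
    have hmono := Tuple.monotone_sort w
    funext p
    have := Tuple.lt_card_le_iff_apply_le_of_monotone (j := p) (a := false) hmono
    have hle : ∀ b : Bool, b ≤ false ↔ b = false := by decide
    rw [hle] at this
    simp only [hle] at this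
    rw [h] at this
    rw [Bool.eq_iff_iff, ← not_iff_not, Bool.not_eq_true, Bool.not_eq_true, ← this,
      sortedWord_eq_false]

theorem card_filter_majority {k : ℕ} (hk : k ≤ n) :
    ((Finset.univ.filter fun p => majority n d k p = false).card : ℤ)
      = if d then (n : ℤ) - k else k := by
  cases d
  · simp only [majority, Bool.false_xor]
    rw [card_filter_sortedWord hk]
    rfl
  · have := Finset.card_filter_add_card_filter_not (s := Finset.univ)
      fun p : Fin n => sortedWord n k p = false
    rw [card_filter_sortedWord hk, Finset.card_univ, Fintype.card_fin] at this
    simp only [Bool.not_eq_false] at this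
    simp only [majority, Bool.true_xor, Bool.not_eq_false', if_true]
    omega

theorem card_filter_cornerWord (hs : sortedWord n k s = false) (ht : sortedWord n k t = true)
    (hk : k ≤ n) (ab : Bool × Bool) :
    ((Finset.univ.filter fun p => cornerWord d k s t ab p = false).card : ℤ)
      = if d then (n : ℤ) - k + ab.1.toNat - ab.2.toNat else k - ab.1.toNat + ab.2.toNat := by
  have hmem : t ∈ Finset.univ.erase s :=
    Finset.mem_erase.2 ⟨(ne_of_sortedWord hs ht).symm, Finset.mem_univ _⟩
  have hmaj := card_filter_majority (d := d) hk
  rw [Finset.card_filter, Nat.cast_sum, ← Finset.add_sum_erase _ _ (Finset.mem_univ s),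
    ← Finset.add_sum_erase _ _ hmem] at hmaj ⊢
  have hrest : ∀ p ∈ (Finset.univ.erase s).erase t,
      (((if cornerWord d k s t ab p = false then 1 else 0 : ℕ) : ℤ))
        = ((if majority n d k p = false then 1 else 0 : ℕ) : ℤ) := by
    intro p hp
    rw [Finset.mem_erase, Finset.mem_erase] at hp
    rw [cornerWord_of_ne _ hp.2.1 hp.1]
  rw [Finset.sum_congr rfl hrest, cornerWord_left hs ht, cornerWord_right]
  generalize ∑ p ∈ (Finset.univ.erase s).erase t,
    ((if majority n d k p = false then 1 else 0 : ℕ) : ℤ) = R at *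
  rw [majority, majority, hs, ht] at hmaj
  rcases ab with ⟨a, b⟩
  cases d <;> cases a <;> cases b <;>
    simp only [Bool.xor_false, Bool.xor_true, Bool.not_true, Bool.not_false, reduceCtorEq,
      if_true, if_false, Bool.false_eq_true, Bool.toNat_true, Bool.toNat_false, Nat.cast_one,
      Nat.cast_zero] at hmaj ⊢ <;> omega

end CornerWord

/-- The blocks have sizes `k` and `n - k`, so a corner word has `k - a + b` letters `false` for `d =
false` and `n - k + a - b` for `d = true`. Equating this with `N` gives the condition. -/
theorem rank_eigenSubmodule {k N : ℕ} (hk : 1 ≤ k) (hkn : k < n) (hN : N ≤ n)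
    (hlam : IsEigenvaluePair q lam) (hq : q ≠ 0) (hq' : q ≠ -1) (d : Bool) :
    Module.rank K (eigenSubmodule q n lam (fun c => lam (xor d c)) N k)
      = Nat.card {ab : Bool × Bool // (ab.1.toNat : ℤ) - ab.2.toNat
          = if d then (N : ℤ) + k - n else k - N} := by
  have hs : sortedWord n k ⟨0, by omega⟩ = false := by rw [sortedWord_eq_false]; exact hk
  have ht : sortedWord n k ⟨n - 1, by omega⟩ = true := by
    rw [sortedWord_eq_true]
    change k ≤ n - 1
    omega
  rw [rank_eigenSubmodule_eq_card hs ht hlam hq hq']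
  congr 1
  refine Nat.card_congr (Equiv.subtypeEquivRight fun ab => ?_)
  have := card_filter_cornerWord (d := d) hs ht hkn.le ab
  rw [hasContent_iff hN, ← Nat.cast_inj (R := ℤ), this]
  cases d <;> simp only [if_true, if_false, Bool.false_eq_true] <;> omega

theorem card_difference_eq (z : ℤ) :
    (2 ≤ |z| → Nat.card {ab : Bool × Bool // (ab.1.toNat : ℤ) - ab.2.toNat = z} = 0) ∧
    (|z| = 1 → Nat.card {ab : Bool × Bool // (ab.1.toNat : ℤ) - ab.2.toNat = z} = 1) ∧
    (z = 0 → Nat.card {ab : Bool × Bool // (ab.1.toNat : ℤ) - ab.2.toNat = z} = 2) := by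
  refine ⟨fun h => ?_, fun h => ?_, fun h => ?_⟩
  · rw [Nat.card_eq_zero]
    refine Or.inl ⟨?_⟩
    rintro ⟨ab, rfl⟩
    have := Bool.toNat_le ab.1
    have := Bool.toNat_le ab.2
    have : |(ab.1.toNat : ℤ) - ab.2.toNat| ≤ 1 := abs_le.2 ⟨by omega, by omega⟩
    omega
  · rcases (abs_eq zero_le_one).1 h with rfl | rfl <;> rw [Nat.card_eq_fintype_card] <;> rfl
  · subst h
    rw [Nat.card_eq_fintype_card]
    rfl

/-! ### The idempotents `ε_r` -/

/-- The eigenvalues of the generators in the first and the second block of `ε_r`. -/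
def parityEigenvalue (q : K) (r : ℕ) (c : Bool) : K := if xor (decide (Odd r)) c then q else -1

/-- The size of the first block of `ε_r`. -/
def firstBlock (l r : ℕ) : ℕ := if Odd r then l - r else r

theorem isEigenvaluePair_parityEigenvalue (q : K) (r : ℕ) :
    IsEigenvaluePair q (parityEigenvalue q r) := by
  by_cases h : Odd r
  · exact Or.inl ⟨by simp [parityEigenvalue, h], by simp [parityEigenvalue, h]⟩
  · exact Or.inr ⟨by simp [parityEigenvalue, h], by simp [parityEigenvalue, h]⟩

theorem eps_eq_blockIdempotent (hq : q ≠ 0) {r : ℕ} (hr : r < n) :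
    eps K q n r = blockIdempotent q n (parityEigenvalue q r) (firstBlock n r) := by
  have h₁ : q * q * q⁻¹ = q := mul_inv_cancel_right₀ hq q
  by_cases h : Odd r
  · have h₂ : n - (n - r) = r := by omega
    simp [eps, blockIdempotent, parityEigenvalue, firstBlock, h, x_eq_blockSum K q n hq,
      y_eq_blockSum, h₁, h₂]
  · simp [eps, blockIdempotent, parityEigenvalue, firstBlock, h, x_eq_blockSum K q n hq,
      y_eq_blockSum, h₁, mul_comm (qFactorial q (n - r))]

/-- The two block sums of each idempotent commute, so any factor of the first can be made adjacent
to any factor of the second. -/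
theorem blockIdempotent_mul_eq_zero {mu nu : Bool → K} {k k' : ℕ}
    (h : blockSum K q n (mu false) 1 k * blockSum K q n (nu false) 1 k' = 0 ∨
      blockSum K q n (mu false) 1 k * blockSum K q n (nu true) (k' + 1) n = 0 ∨
      blockSum K q n (mu true) (k + 1) n * blockSum K q n (nu false) 1 k' = 0 ∨
      blockSum K q n (mu true) (k + 1) n * blockSum K q n (nu true) (k' + 1) n = 0) :
    blockIdempotent q n mu k * blockIdempotent q n nu k' = 0 := by
  have c₁ := (commute_blockSum (K := K) (q := q) (n := n) (μ := mu false) (ν := mu true) (a := 1)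
    (b' := n) (Nat.lt_succ_self k)).eq
  have c₂ := (commute_blockSum (K := K) (q := q) (n := n) (μ := nu false) (ν := nu true) (a := 1)
    (b' := n) (Nat.lt_succ_self k')).eq
  rw [blockIdempotent, blockIdempotent, smul_mul_smul_comm]
  refine smul_eq_zero_of_right _ ?_
  have assoc : ∀ a b c d : HeckeAlgebra K q n, b * c = 0 → a * b * (c * d) = 0 := by
    intro a b c d h
    rw [mul_assoc, ← mul_assoc b, h, zero_mul, mul_zero]
  rcases h with h | h | h | h
  · rw [c₁]
    exact assoc _ _ _ _ h
  · rw [c₁, c₂]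
    exact assoc _ _ _ _ h
  · exact assoc _ _ _ _ h
  · rw [c₂]
    exact assoc _ _ _ _ h

end Dimension

/-! ### Idempotency, orthogonality and corner dimensions of the `ε_r`. -/

section Main

variable {K : Type*} [Field K] {q : K} {l : ℕ}

theorem isIdempotentElem_eps (hq : IsPrimitiveRoot q l) {r : ℕ} (hr : 1 ≤ r) (hrl : r < l) :
    IsIdempotentElem (eps K q l r) := by
  rw [eps_eq_blockIdempotent (hq.ne_zero (by omega)) hrl]
  refine isIdempotentElem_blockIdempotent (isEigenvaluePair_parityEigenvalue q r) hq ?_ ?_ <;>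
    unfold firstBlock <;> split_ifs <;> omega

theorem ne_neg_one_of_isPrimitiveRoot (hl : 3 ≤ l) (hq : IsPrimitiveRoot q l) : q ≠ -1 := by
  rintro rfl
  exact hq.pow_ne_one_of_pos_of_lt two_ne_zero (by omega) (by ring)

/-- It suffices to find two adjacent places `m + 1`, `m + 2` lying in a symmetrised block of one
idempotent and an antisymmetrised block of the other. For equal parity `r` and `u` differ by at
least 2, so opposite blocks overlap in two places. -/
theorem eps_mul_eps_eq_zero (hl : 3 ≤ l) (hq : IsPrimitiveRoot q l) {r u : ℕ} (hr : 1 ≤ r)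
    (hrl : r < l) (hu : 1 ≤ u) (hul : u < l) (hne : r ≠ u) :
    eps K q l r * eps K q l u = 0 := by
  have hq₀ : q ≠ 0 := hq.ne_zero (by omega)
  have hq₁ := ne_neg_one_of_isPrimitiveRoot hl hq
  rw [eps_eq_blockIdempotent hq₀ hrl, eps_eq_blockIdempotent hq₀ hul]
  have zero : ∀ (c c' : Bool) (a b a' b' : ℕ), xor (decide (Odd r)) c ≠ xor (decide (Odd u)) c' →
      ∀ m : ℕ, m + 2 ≤ l → a ≤ m + 1 → m + 2 ≤ b → a' ≤ m + 1 → m + 2 ≤ b' →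
      blockSum K q l (parityEigenvalue q r c) a b *
        blockSum K q l (parityEigenvalue q u c') a' b' = 0 := by
    intro c c' a b a' b' hcc m hm h₁ h₂ h₃ h₄
    refine blockSum_mul_blockSum_eq_zero (i := ⟨m, by omega⟩) hq₀
      ((isEigenvaluePair_parityEigenvalue q r).quad c)
      ((isEigenvaluePair_parityEigenvalue q u).quad c') ?_ ⟨h₁, h₂⟩ ⟨h₃, h₄⟩
    unfold parityEigenvalue
    intro h
    cases h₅ : xor (decide (Odd r)) c <;> cases h₆ : xor (decide (Odd u)) c' <;>
      simp only [h₅, h₆] at h hcc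
    · exact hcc rfl
    · exact hq₁ (by simpa using h.symm)
    · exact hq₁ (by simpa using h)
    · exact hcc rfl
  refine blockIdempotent_mul_eq_zero ?_
  unfold firstBlock
  rcases Nat.even_or_odd r with h₁ | h₁ <;> rcases Nat.even_or_odd u with h₂ | h₂
  · rw [if_neg (Nat.not_odd_iff_even.2 h₁), if_neg (Nat.not_odd_iff_even.2 h₂)]
    obtain ⟨x, rfl⟩ := h₁
    obtain ⟨y, rfl⟩ := h₂
    have e₁ : ¬ Odd (x + x) := Nat.not_odd_iff_even.2 ⟨x, rfl⟩
    have e₂ : ¬ Odd (y + y) := Nat.not_odd_iff_even.2 ⟨y, rfl⟩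
    rcases lt_or_gt_of_ne hne with h | h
    · exact Or.inr (Or.inr (Or.inl (zero _ _ _ _ _ _ (by simp [e₁, e₂]) (x + x) (by omega)
        (by omega) (by omega) (by omega) (by omega))))
    · exact Or.inr (Or.inl (zero _ _ _ _ _ _ (by simp [e₁, e₂]) (y + y) (by omega)
        (by omega) (by omega) (by omega) (by omega)))
  · rw [if_neg (Nat.not_odd_iff_even.2 h₁), if_pos h₂]
    have e₁ : ¬ Odd r := Nat.not_odd_iff_even.2 h₁
    obtain ⟨x, rfl⟩ := h₁
    -- For different parity, blocks in the same position have opposite type. The first blocks share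
    -- the places 1, 2 unless the odd index is `l - 1`; then the second blocks share `l - 1`, `l`.
    by_cases h : u + 2 ≤ l
    · exact Or.inl (zero _ _ _ _ _ _ (by simp [e₁, h₂]) 0 (by omega)
        (by omega) (by omega) (by omega) (by omega))
    · exact Or.inr (Or.inr (Or.inr (zero _ _ _ _ _ _ (by simp [e₁, h₂]) (l - 2) (by omega)
        (by omega) (by omega) (by omega) (by omega))))
  · rw [if_pos h₁, if_neg (Nat.not_odd_iff_even.2 h₂)]
    have e₂ : ¬ Odd u := Nat.not_odd_iff_even.2 h₂
    obtain ⟨y, rfl⟩ := h₂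
    by_cases h : r + 2 ≤ l
    · exact Or.inl (zero _ _ _ _ _ _ (by simp [e₂, h₁]) 0 (by omega)
        (by omega) (by omega) (by omega) (by omega))
    · exact Or.inr (Or.inr (Or.inr (zero _ _ _ _ _ _ (by simp [e₂, h₁]) (l - 2) (by omega)
        (by omega) (by omega) (by omega) (by omega))))
  · rw [if_pos h₁, if_pos h₂]
    have e₁ := h₁
    have e₂ := h₂
    obtain ⟨x, rfl⟩ := h₁
    obtain ⟨y, rfl⟩ := h₂
    rcases lt_or_gt_of_ne hne with h | h
    · exact Or.inr (Or.inl (zero _ _ _ _ _ _ (by simp [e₁, e₂]) (l - (2 * y + 1)) (by omega)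
        (by omega) (by omega) (by omega) (by omega)))
    · exact Or.inr (Or.inr (Or.inl (zero _ _ _ _ _ _ (by simp [e₁, e₂]) (l - (2 * x + 1))
        (by omega) (by omega) (by omega) (by omega) (by omega))))

theorem exists_rank_corner_eps_eq (hl : 3 ≤ l) (hq : IsPrimitiveRoot q l) {r u : ℕ} (hr : 1 ≤ r)
    (hrl : r < l) (hu : 1 ≤ u) (hul : u < l) :
    ∃ z : ℤ, |z| = |(r : ℤ) - u| ∧
      Module.rank K (corner K q l (eps K q l r) (eps K q l u))
        = Nat.card {ab : Bool × Bool // (ab.1.toNat : ℤ) - ab.2.toNat = z} := by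
  have hq₀ : q ≠ 0 := hq.ne_zero (by omega)
  have hb : ∀ r, 1 ≤ r → r < l → 1 ≤ firstBlock l r ∧ firstBlock l r < l := by
    intro r h₁ h₂
    unfold firstBlock
    split_ifs <;> omega
  obtain ⟨hr₁, hr₂⟩ := hb r hr hrl
  obtain ⟨hu₁, hu₂⟩ := hb u hu hul
  -- Relative to the word module of `ε_u`, the eigenvalues of `ε_r` are the same pair, interchanged
  -- exactly when the parities of `r` and `u` differ.
  have hmu : parityEigenvalue q r
      = fun c => parityEigenvalue q u (xor (xor (decide (Odd u)) (decide (Odd r))) c) := by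
    funext c
    rw [parityEigenvalue, parityEigenvalue, ← Bool.xor_assoc, ← Bool.xor_assoc, Bool.xor_self,
      Bool.false_xor]
  -- This is the required difference of deviations, with `N` the first block of `ε_u` and `k` that
  -- of `ε_r`; in each parity case it simplifies to `r - u` or `u - r`.
  refine ⟨if xor (decide (Odd u)) (decide (Odd r)) then (firstBlock l u : ℤ) + firstBlock l r - l
    else firstBlock l r - firstBlock l u, ?_, ?_⟩
  · unfold firstBlock
    by_cases h₁ : Odd r <;> by_cases h₂ : Odd u <;>
      simp only [h₁, h₂, decide_true, decide_false, Bool.xor_true, Bool.xor_false,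
        Bool.not_true, Bool.not_false, if_true, if_false, Bool.false_eq_true] <;>
      rw [abs_eq_abs] <;> omega
  · rw [eps_eq_blockIdempotent hq₀ hrl, eps_eq_blockIdempotent hq₀ hul,
      rank_corner_blockIdempotent (isEigenvaluePair_parityEigenvalue q u)
        (isEigenvaluePair_parityEigenvalue q r) hq hu₁ hu₂ hr₁ hr₂, hmu,
      rank_eigenSubmodule hr₁ hr₂ hu₂.le (isEigenvaluePair_parityEigenvalue q u) hq₀
        (ne_neg_one_of_isPrimitiveRoot hl hq)]

end Main

end IwahoriHecke

theorem proposition3p4 {K : Type*} [Field K] (l : ℕ) (hl : 3 ≤ l) (q : K)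
    (hq : IsPrimitiveRoot q l) :
    (∀ r ∈ Finset.Icc 1 (l - 1),
      IsIdempotentElem (IwahoriHecke.eps K q l r)) ∧
    (∀ r ∈ Finset.Icc 1 (l - 1), ∀ u ∈ Finset.Icc 1 (l - 1), r ≠ u →
      IwahoriHecke.eps K q l r * IwahoriHecke.eps K q l u = 0) ∧
    (∀ r ∈ Finset.Icc 1 (l - 1), ∀ u ∈ Finset.Icc 1 (l - 1),
      (2 ≤ |(r : ℤ) - (u : ℤ)| →
        Module.rank K (IwahoriHecke.corner K q l
          (IwahoriHecke.eps K q l r) (IwahoriHecke.eps K q l u)) = 0) ∧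
      (u = r + 1 ∨ u + 1 = r →
        Module.rank K (IwahoriHecke.corner K q l
          (IwahoriHecke.eps K q l r) (IwahoriHecke.eps K q l u)) = 1) ∧
      (r = u →
        Module.rank K (IwahoriHecke.corner K q l
          (IwahoriHecke.eps K q l r) (IwahoriHecke.eps K q l u)) = 2)) := by
  refine ⟨fun r hr => ?_, fun r hr u hu hne => ?_, fun r hr u hu => ?_⟩
  · rw [Finset.mem_Icc] at hr
    exact IwahoriHecke.isIdempotentElem_eps hq hr.1 (by omega)
  · rw [Finset.mem_Icc] at hr hu
    exact IwahoriHecke.eps_mul_eps_eq_zero hl hq hr.1 (by omega) hu.1 (by omega) hne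
  · rw [Finset.mem_Icc] at hr hu
    obtain ⟨z, hz, hrank⟩ := IwahoriHecke.exists_rank_corner_eps_eq hl hq hr.1
      (show r < l by omega) hu.1 (show u < l by omega)
    obtain ⟨h₀, h₁, h₂⟩ := IwahoriHecke.card_difference_eq z
    rw [hrank]
    refine ⟨fun h => ?_, fun h => ?_, fun h => ?_⟩
    · rw [h₀ (by rwa [hz]), Nat.cast_zero]
    · rw [h₁ (by rw [hz, abs_eq zero_le_one]; omega), Nat.cast_one]
    · rw [h₂ (by rwa [h, sub_self, abs_zero, abs_eq_zero] at hz), Nat.cast_ofNat]
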